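/- Let $G$ be an abelian group and let $k$ be a commutative $G$-ring, that is, a commutative unital ring on which $G$ acts by ring automorphisms. Let $\delta\in k$ be arbitrary and let $n$ be an odd natural number. A $G$-Temperley-Lieb $n$-diagram is a planar perfect matching of two columns of $n$ nodes (drawn without crossings in the strip between the columns) whose edges are labelled by elements of $G$. The $G$-Temperley-Lieb algebra $G\mathcal{TL}_n(\delta)$ is the $k$-algebra of formal $k$-linear combinations of $G$-Temperley-Lieb $n$-diagrams. The product of two diagrams is obtained by identifying the right-hand nodes of the first with the left-hand nodes of the second, forgetting the middle nodes, labelling each resulting edge by the product of the labels along it, and replacing each closed loop whose labels multiply to $g\in G$ by a factor $g\cdot\delta\in k$. The product is extended $k$-bilinearly. The trivial module $\mathbb{1}$ of $G\mathcal{TL}_n(\delta)$ (left or right) is $k$, on which diagrams with no left-to-left and no right-to-right connections act as $1$ and all other diagrams act as $0$. The trivial module $\mathbb{1}$ of the group algebra $k[G^n]$ is $k$ with every group element acting as $1$. Then there is an isomorphism of graded $k$-modules \[\mathrm{Tor}_{\star}^{G\mathcal{TL}_n(\delta)}(\mathbb{1},\mathbb{1})\;\cong\;\mathrm{Tor}_{\star}^{k[G^n]}(\mathbb{1},\mathbb{1}).\]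 In particular, for $n=1$, $\mathrm{Tor}_{\star}^{G\mathcal{TL}_1(\delta)}(\mathbb{1},\mathbb{1})\cong H_{\star}(G;k)$, the homology of $G$ with coefficients in $k$ with trivial action. -/

import Mathlib

set_option linter.unusedSectionVars false
set_option linter.unusedVariables false

universe u

namespace GTemperleyLieb

/-- A graph on the node set `V` in which each node lies on at most one edge, with edges labelled
by elements of `G`: `mate v` is the other end of the edge at `v` (or `v` itself if there is no
edge at `v`), `label v` is the label of the edge at `v`. The multiset `loops` records the labels
of the closed loops that have been formed, and deleted, so far. -/
@[ext]
structure LabelledGraph (G V : Type*) where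
  mate : V → V
  label : V → G
  loops : Multiset G

namespace LabelledGraph

variable {G V W : Type*} [CommGroup G] [DecidableEq V] [DecidableEq W]

/-- Identify the node `p` with the node `q` and forget the resulting node. The edge at `p` and
the edge at `q` become one edge, labelled by the product of the two labels. If `p` and `q` are
the two ends of the same edge, a loop has been formed; it is deleted and its label recorded. -/
def glue (p q : V) (D : LabelledGraph G V) : LabelledGraph G V where
  mate a :=
    if a = p ∨ a = q then a
    else if D.mate a = p then D.mate q
    else if D.mate a = q then D.mate p
    else D.mate a
  label a :=
    if a = p ∨ a = q then 1
    else if D.mate a = p then D.label a * D.label q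
    else if D.mate a = q then D.label a * D.label p
    else D.label a
  loops := if D.mate p = q then D.label p ::ₘ D.loops else D.loops

/-- Perform the gluings in a list one after another (see `Live.glueList_comm`: the order does not
matter). In the result, the label of an edge is the product of the labels along the path that it
comes from, and similarly for the recorded loops. -/
def glueList (l : List (V × V)) (D : LabelledGraph G V) : LabelledGraph G V :=
  l.foldl (fun E e => glue e.1 e.2 E) D

/-- `D` is a perfect matching of the nodes in `S`, and has no edges at the other nodes. -/
structure Live (S : Set V) (D : LabelledGraph G V) : Prop where
  mem : ∀ a ∈ S, D.mate a ∈ S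
  ne : ∀ a ∈ S, D.mate a ≠ a
  invol : ∀ a, D.mate (D.mate a) = a
  label_mate : ∀ a, D.label (D.mate a) = D.label a
  dead : ∀ a, a ∉ S → D.mate a = a
  dead_label : ∀ a, a ∉ S → D.label a = 1

variable {S : Set V} {D : LabelledGraph G V} {p q r s : V}

theorem Live.glue (h : Live S D) (hp : p ∈ S) (hq : q ∈ S) (hpq : p ≠ q) :
    Live (S \ {p, q}) (D.glue p q) := by
  obtain ⟨h1, h2, h3, h4, h5, h6⟩ := h
  constructor
  · intro a ha
    simp only [LabelledGraph.glue, Set.mem_sdiff, Set.mem_insert_iff, Set.mem_singleton_iff] at *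
    grind
  · intro a ha
    simp only [LabelledGraph.glue, Set.mem_sdiff, Set.mem_insert_iff, Set.mem_singleton_iff] at *
    grind
  · intro a
    simp only [LabelledGraph.glue]
    grind
  · intro a
    simp only [LabelledGraph.glue]
    have := mul_comm (D.label p) (D.label q)
    grind
  · intro a ha
    simp only [LabelledGraph.glue, Set.mem_sdiff, Set.mem_insert_iff, Set.mem_singleton_iff] at *
    grind
  · intro a ha
    simp only [LabelledGraph.glue, Set.mem_sdiff, Set.mem_insert_iff, Set.mem_singleton_iff] at *
    grind

theorem Live.glue_comm (h : Live S D) (hpq : p ≠ q) (hrs : r ≠ s) (hpr : p ≠ r) (hps : p ≠ s)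
    (hqr : q ≠ r) (hqs : q ≠ s) :
    (D.glue p q).glue r s = (D.glue r s).glue p q := by
  obtain ⟨h1, h2, h3, h4, h5, h6⟩ := h
  ext a
  · simp only [LabelledGraph.glue]
    grind
  · simp only [LabelledGraph.glue]
    grind
  · have := Multiset.cons_swap (D.label p) (D.label r) D.loops
    simp only [LabelledGraph.glue]
    grind

/-- The pairs in `l` consist of distinct nodes of `S`. -/
def Avail : Set V → List (V × V) → Prop
  | _, [] => True
  | S, e :: l => e.1 ∈ S ∧ e.2 ∈ S ∧ e.1 ≠ e.2 ∧ Avail (S \ {e.1, e.2}) l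

theorem Avail.mono {l : List (V × V)} : ∀ {S T : Set V}, S ⊆ T → Avail S l → Avail T l := by
  induction l with
  | nil => intros; trivial
  | cons e l ih =>
    rintro S T hST ⟨h1, h2, h3, h4⟩
    exact ⟨hST h1, hST h2, h3, ih (Set.sdiff_subset_sdiff_left hST) h4⟩

theorem avail_map {ι : Type*} (P Q : ι → V) (hP : Function.Injective P)
    (hQ : Function.Injective Q) (hPQ : ∀ i j, P i ≠ Q j) :
    ∀ (L : List ι) (S : Set V), L.Nodup → (∀ i ∈ L, P i ∈ S ∧ Q i ∈ S) →
      Avail S (L.map fun i => (P i, Q i)) := by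
  intro L
  induction L with
  | nil => intros; trivial
  | cons i L ih =>
    intro S hL hS
    rw [List.nodup_cons] at hL
    refine ⟨(hS i (by simp)).1, (hS i (by simp)).2, hPQ i i, ih _ hL.2 ?_⟩
    intro j hj
    have hij : j ≠ i := fun h => hL.1 (h ▸ hj)
    have := hS j (by simp [hj])
    simp only [Set.mem_sdiff, Set.mem_insert_iff, Set.mem_singleton_iff]
    have h1 := hP.ne hij
    have h2 := hQ.ne hij
    have h3 := hPQ i j
    have h4 := hPQ j i
    grind

theorem Live.glueList {l : List (V × V)} : ∀ {S : Set V} {D : LabelledGraph G V},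
    Live S D → Avail S l →
      Live (S \ {v | ∃ e ∈ l, v = e.1 ∨ v = e.2}) (D.glueList l) := by
  induction l with
  | nil => intro S D h _; simpa [LabelledGraph.glueList] using h
  | cons e l ih =>
    rintro S D h ⟨h1, h2, h3, h4⟩
    have := ih (h.glue h1 h2 h3) h4
    show Live _ ((D.glue e.1 e.2).glueList l)
    convert this using 1
    ext v
    simp only [Set.mem_sdiff, Set.mem_insert_iff, Set.mem_singleton_iff, Set.mem_ofPred_eq,
      List.mem_cons]
    grind

theorem Live.glue_glueList {e : V × V} {l : List (V × V)} :
    ∀ {S : Set V} {D : LabelledGraph G V}, Live S D → Avail S (e :: l) →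
      (D.glueList l).glue e.1 e.2 = (D.glue e.1 e.2).glueList l := by
  induction l with
  | nil => intros; rfl
  | cons f l ih =>
    rintro S D h ⟨h1, h2, h3, h4, h5, h6, h7⟩
    simp only [Set.mem_sdiff, Set.mem_insert_iff, Set.mem_singleton_iff, not_or] at h4 h5
    have hc : (D.glue e.1 e.2).glue f.1 f.2 = (D.glue f.1 f.2).glue e.1 e.2 :=
      h.glue_comm h3 h6 (Ne.symm h4.2.1) (Ne.symm h5.2.1) (Ne.symm h4.2.2) (Ne.symm h5.2.2)
    have h8 : Avail (S \ {f.1, f.2}) (e :: l) := by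
      refine ⟨?_, ?_, h3, h7.mono ?_⟩
      · simp only [Set.mem_sdiff, Set.mem_insert_iff, Set.mem_singleton_iff]
        grind
      · simp only [Set.mem_sdiff, Set.mem_insert_iff, Set.mem_singleton_iff]
        grind
      · intro x
        simp only [Set.mem_sdiff, Set.mem_insert_iff, Set.mem_singleton_iff]
        grind
    have := ih (h.glue h4.1 h5.1 h6) h8
    show ((D.glue f.1 f.2).glueList l).glue e.1 e.2 =
      ((D.glue e.1 e.2).glue f.1 f.2).glueList l
    rw [this, hc]

theorem Live.glueList_comm {m l : List (V × V)} :
    ∀ {S : Set V} {D : LabelledGraph G V}, Live S D → Avail S (m ++ l) →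
      (D.glueList l).glueList m = (D.glueList m).glueList l := by
  induction m with
  | nil => intros; rfl
  | cons e m ih =>
    rintro S D h ⟨h1, h2, h3, h4⟩
    have hl : Avail S (e :: l) := by
      refine ⟨h1, h2, h3, ?_⟩
      clear ih
      generalize S \ {e.1, e.2} = T at h4
      induction m generalizing T with
      | nil => exact h4
      | cons f m ih' => exact (ih' _ h4.2.2.2).mono Set.sdiff_subset
    show ((D.glueList l).glue e.1 e.2).glueList m = ((D.glue e.1 e.2).glueList m).glueList l
    rw [h.glue_glueList hl, ih (h.glue h1 h2 h3) h4]

/-- `f` embeds `D` into `E` as a union of edges of `E`; the loops of `E` are those of `D` and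
those in `T`. -/
structure Emb (f : V → W) (T : Multiset G) (D : LabelledGraph G V) (E : LabelledGraph G W) :
    Prop where
  mate : ∀ a, E.mate (f a) = f (D.mate a)
  label : ∀ a, E.label (f a) = D.label a
  loops : E.loops = T + D.loops

theorem Emb.glue {f : V → W} {T : Multiset G} {D : LabelledGraph G V} {E : LabelledGraph G W}
    (hf : Function.Injective f) (h : Emb f T D E) (p q : V) :
    Emb f T (D.glue p q) (E.glue (f p) (f q)) := by
  obtain ⟨h1, h2, h3⟩ := h
  constructor
  · intro a
    simp only [LabelledGraph.glue, h1, hf.eq_iff]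
    split_ifs <;> rfl
  · intro a
    simp only [LabelledGraph.glue, h1, h2, hf.eq_iff]
  · simp only [LabelledGraph.glue, h1, h2, h3, hf.eq_iff]
    split_ifs <;> simp

theorem Emb.glueList {f : V → W} {T : Multiset G} (hf : Function.Injective f)
    (l : List (V × V)) : ∀ {D : LabelledGraph G V} {E : LabelledGraph G W}, Emb f T D E →
      Emb f T (D.glueList l) (E.glueList (l.map (Prod.map f f))) := by
  induction l with
  | nil => intro D E h; exact h
  | cons e l ih => intro D E h; exact ih (h.glue hf e.1 e.2)

theorem glueList_untouched (l : List (V × V)) : ∀ {D : LabelledGraph G V} {a : V},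
    (∀ e ∈ l, a ≠ e.1 ∧ a ≠ e.2 ∧ D.mate a ≠ e.1 ∧ D.mate a ≠ e.2) →
      (D.glueList l).mate a = D.mate a ∧ (D.glueList l).label a = D.label a := by
  induction l with
  | nil => intros; exact ⟨rfl, rfl⟩
  | cons e l ih =>
    intro D a h
    have he := h e (by simp)
    have h1 : (D.glue e.1 e.2).mate a = D.mate a := by
      simp [LabelledGraph.glue, he.1, he.2.1, he.2.2.1, he.2.2.2]
    have h2 : (D.glue e.1 e.2).label a = D.label a := by
      simp [LabelledGraph.glue, he.1, he.2.1, he.2.2.1, he.2.2.2]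
    have := @ih (D.glue e.1 e.2) a (by
      intro e' he'
      rw [h1]
      exact h e' (by simp [he']))
    rw [h1, h2] at this
    exact this

end LabelledGraph

open LabelledGraph

/-- The nodes of an `n`-diagram: the left column (`Sum.inl`) and the right column (`Sum.inr`). -/
abbrev Node (n : ℕ) := Fin n ⊕ Fin n

/-- A `G`-Brauer `n`-diagram: a graph on two columns of `n` nodes, each node being connected to
exactly one other node (`mate`) by an edge labelled by an element of `G`. -/
@[ext]
structure BrauerDiagram (G : Type*) (n : ℕ) where
  mate : Node n → Node n
  label : Node n → G
  mate_mate : ∀ v, mate (mate v) = v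
  mate_ne : ∀ v, mate v ≠ v
  label_mate : ∀ v, label (mate v) = label v

namespace BrauerDiagram

variable {G : Type*} [CommGroup G] {n : ℕ}

/-- The two diagrams `x` and `y` side by side. -/
def juxtapose (x y : BrauerDiagram G n) : LabelledGraph G (Node n ⊕ Node n) where
  mate := Sum.map x.mate y.mate
  label := Sum.elim x.label y.label
  loops := 0

/-- The pairs (`i`-th right-hand node of `x`, `i`-th left-hand node of `y`). -/
def middle (n : ℕ) : List ((Node n ⊕ Node n) × (Node n ⊕ Node n)) :=
  (List.finRange n).map fun i => (Sum.inl (Sum.inr i), Sum.inr (Sum.inl i))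

/-- The concatenation of `x` and `y`, with the middle nodes forgotten. -/
def concat (x y : BrauerDiagram G n) : LabelledGraph G (Node n ⊕ Node n) :=
  (juxtapose x y).glueList (middle n)

/-- The left-hand nodes of `x` and the right-hand nodes of `y`. -/
def outer : Node n → Node n ⊕ Node n :=
  Sum.map Sum.inl Sum.inr

theorem outer_injective : Function.Injective (outer (n := n)) := by
  rintro (a | a) (b | b) h <;> simp_all [outer]

theorem juxtapose_live (x y : BrauerDiagram G n) : Live Set.univ (juxtapose x y) := by
  constructor
  · intros; trivial
  · rintro (a | a) _ <;> simp [juxtapose, x.mate_ne, y.mate_ne]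
  · rintro (a | a) <;> simp [juxtapose, x.mate_mate, y.mate_mate]
  · rintro (a | a) <;> simp [juxtapose, x.label_mate, y.label_mate]
  · intro a ha; exact absurd trivial ha
  · intro a ha; exact absurd trivial ha

theorem middle_avail : Avail Set.univ (middle n) :=
  avail_map _ _ (fun i j h => by simpa using h) (fun i j h => by simpa using h)
    (fun i j h => by simp at h) _ _ (List.nodup_finRange n) (fun _ _ => ⟨trivial, trivial⟩)

theorem concat_live (x y : BrauerDiagram G n) : Live (Set.range outer) (concat x y) := by
  have h := (juxtapose_live x y).glueList middle_avail
  show Live _ ((juxtapose x y).glueList (middle n))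
  convert h using 1
  ext v
  rcases v with (v | v) | (v | v) <;> simp [middle, outer]

/-- Reading an outer node of the concatenation as a node of the composite. -/
def forget : Node n ⊕ Node n → Node n := Sum.elim id id

@[simp] theorem forget_outer (v : Node n) : forget (outer v) = v := by
  rcases v with v | v <;> rfl

theorem outer_forget_mate (x y : BrauerDiagram G n) (v : Node n) :
    outer (forget ((concat x y).mate (outer v))) = (concat x y).mate (outer v) := by
  obtain ⟨w, hw⟩ := (concat_live x y).mem (outer v) ⟨v, rfl⟩
  rw [← hw, forget_outer]

/-- The composite of two diagrams: identify the right-hand nodes of `x` with the left-hand nodes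
of `y`, forget the middle nodes, multiply the labels along the new edges, delete the loops. -/
def comp (x y : BrauerDiagram G n) : BrauerDiagram G n where
  mate v := forget ((concat x y).mate (outer v))
  label v := (concat x y).label (outer v)
  mate_mate v := by
    rw [outer_forget_mate, (concat_live x y).invol, forget_outer]
  mate_ne v h := by
    have h1 := outer_forget_mate x y v
    rw [h] at h1
    exact (concat_live x y).ne (outer v) ⟨v, rfl⟩ h1.symm
  label_mate v := by
    rw [outer_forget_mate, (concat_live x y).label_mate]

/-- The labels of the loops that are deleted when `x` and `y` are composed; the label of a loop is
the product of the labels of its edges. -/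
def loops (x y : BrauerDiagram G n) : Multiset G := (concat x y).loops

theorem outer_comp_mate (x y : BrauerDiagram G n) (v : Node n) :
    outer ((comp x y).mate v) = (concat x y).mate (outer v) := outer_forget_mate x y v

/-- The diagram with `n` horizontal edges, labelled by `1`. -/
def one (G : Type*) [CommGroup G] (n : ℕ) : BrauerDiagram G n where
  mate := Sum.swap
  label _ := 1
  mate_mate v := Sum.swap_swap v
  mate_ne v := by rcases v with v | v <;> simp
  label_mate _ := rfl

section assoc

variable (x y z : BrauerDiagram G n)

/-- Three diagrams side by side. -/
def juxtapose₃ : LabelledGraph G (Node n ⊕ (Node n ⊕ Node n)) where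
  mate := Sum.map x.mate (Sum.map y.mate z.mate)
  label := Sum.elim x.label (Sum.elim y.label z.label)
  loops := 0

theorem juxtapose₃_live : Live Set.univ (juxtapose₃ x y z) := by
  constructor
  · intros; trivial
  · rintro (a | a | a) _ <;> simp [juxtapose₃, x.mate_ne, y.mate_ne, z.mate_ne]
  · rintro (a | a | a) <;> simp [juxtapose₃, x.mate_mate, y.mate_mate, z.mate_mate]
  · rintro (a | a | a) <;> simp [juxtapose₃, x.label_mate, y.label_mate, z.label_mate]
  · intro a ha; exact absurd trivial ha
  · intro a ha; exact absurd trivial ha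

/-- The inclusion of the first two diagrams. -/
def incl₁₂ : Node n ⊕ Node n → Node n ⊕ (Node n ⊕ Node n) := Sum.map id Sum.inl

/-- The pairs to be glued between the first two diagrams. -/
def middle₁₂ (n : ℕ) := (middle n).map (Prod.map incl₁₂ incl₁₂)

/-- The pairs to be glued between the last two diagrams. -/
def middle₂₃ (n : ℕ) :
    List ((Node n ⊕ (Node n ⊕ Node n)) × (Node n ⊕ (Node n ⊕ Node n))) :=
  (middle n).map (Prod.map Sum.inr Sum.inr)

/-- The inclusion of the outer nodes of the first two diagrams and the nodes of the third. -/
def outer₁₂ : Node n ⊕ Node n → Node n ⊕ (Node n ⊕ Node n) :=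
  Sum.elim (fun v => incl₁₂ (outer v)) (fun v => Sum.inr (Sum.inr v))

/-- The inclusion of the nodes of the first diagram and the outer nodes of the last two. -/
def outer₂₃ : Node n ⊕ Node n → Node n ⊕ (Node n ⊕ Node n) :=
  Sum.map id outer

theorem incl₁₂_injective : Function.Injective (incl₁₂ (n := n)) :=
  Function.Injective.sumMap Function.injective_id Sum.inl_injective

theorem outer₂₃_injective : Function.Injective (outer₂₃ (n := n)) :=
  Function.Injective.sumMap Function.injective_id outer_injective

theorem outer₁₂_injective : Function.Injective (outer₁₂ (n := n)) := by
  rintro ((a | a) | a) ((b | b) | b) h <;> simp_all [outer₁₂, incl₁₂, outer]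

theorem emb_left : Emb outer₁₂ (loops x y) (juxtapose (comp x y) z)
    ((juxtapose₃ x y z).glueList (middle₁₂ n)) := by
  have h0 : Emb incl₁₂ 0 (juxtapose x y) (juxtapose₃ x y z) := by
    constructor
    · rintro (a | a) <;> simp [juxtapose, juxtapose₃, incl₁₂]
    · rintro (a | a) <;> simp [juxtapose, juxtapose₃, incl₁₂]
    · simp [juxtapose, juxtapose₃]
  have h1 : Emb incl₁₂ 0 (concat x y) ((juxtapose₃ x y z).glueList (middle₁₂ n)) :=
    h0.glueList incl₁₂_injective (middle n)
  have h2 : ∀ v : Node n,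
      ((juxtapose₃ x y z).glueList (middle₁₂ n)).mate (Sum.inr (Sum.inr v)) =
        Sum.inr (Sum.inr (z.mate v)) ∧
      ((juxtapose₃ x y z).glueList (middle₁₂ n)).label (Sum.inr (Sum.inr v)) = z.label v := by
    intro v
    refine glueList_untouched (middle₁₂ n) ?_
    intro e he
    simp only [middle₁₂, middle, List.map_map, List.mem_map] at he
    obtain ⟨i, -, rfl⟩ := he
    simp [incl₁₂, juxtapose₃]
  constructor
  · rintro (v | v)
    · show _ = incl₁₂ (outer ((comp x y).mate v))
      rw [outer_comp_mate, ← h1.mate]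
      rfl
    · exact (h2 v).1
  · rintro (v | v)
    · exact h1.label (outer v)
    · exact (h2 v).2
  · rw [h1.loops]
    simp [juxtapose, loops]

theorem emb_right : Emb outer₂₃ (loops y z) (juxtapose x (comp y z))
    ((juxtapose₃ x y z).glueList (middle₂₃ n)) := by
  have h0 : Emb Sum.inr 0 (juxtapose y z) (juxtapose₃ x y z) := by
    constructor
    · rintro (a | a) <;> simp [juxtapose, juxtapose₃]
    · rintro (a | a) <;> simp [juxtapose, juxtapose₃]
    · simp [juxtapose, juxtapose₃]
  have h1 : Emb Sum.inr 0 (concat y z) ((juxtapose₃ x y z).glueList (middle₂₃ n)) :=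
    h0.glueList Sum.inr_injective (middle n)
  have h2 : ∀ v : Node n,
      ((juxtapose₃ x y z).glueList (middle₂₃ n)).mate (Sum.inl v) = Sum.inl (x.mate v) ∧
      ((juxtapose₃ x y z).glueList (middle₂₃ n)).label (Sum.inl v) = x.label v := by
    intro v
    refine glueList_untouched (middle₂₃ n) ?_
    intro e he
    simp only [middle₂₃, middle, List.map_map, List.mem_map] at he
    obtain ⟨i, -, rfl⟩ := he
    simp [juxtapose₃]
  constructor
  · rintro (v | v)
    · exact (h2 v).1
    · show _ = Sum.inr (outer ((comp y z).mate v))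
      rw [outer_comp_mate, ← h1.mate]
      rfl
  · rintro (v | v)
    · exact (h2 v).2
    · exact h1.label (outer v)
  · rw [h1.loops]
    simp [juxtapose, loops]

theorem glue_both :
    ((juxtapose₃ x y z).glueList (middle₁₂ n)).glueList (middle₂₃ n) =
      ((juxtapose₃ x y z).glueList (middle₂₃ n)).glueList (middle₁₂ n) := by
  refine (juxtapose₃_live x y z).glueList_comm ?_
  let P : Fin n ⊕ Fin n → Node n ⊕ (Node n ⊕ Node n) :=
    Sum.elim (fun i => Sum.inr (Sum.inl (Sum.inr i))) (fun i => Sum.inl (Sum.inr i))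
  let Q : Fin n ⊕ Fin n → Node n ⊕ (Node n ⊕ Node n) :=
    Sum.elim (fun i => Sum.inr (Sum.inr (Sum.inl i))) (fun i => Sum.inr (Sum.inl (Sum.inl i)))
  have key : middle₂₃ n ++ middle₁₂ n =
      ((List.finRange n).map Sum.inl ++ (List.finRange n).map Sum.inr).map
        fun i => (P i, Q i) := by
    simp [middle₁₂, middle₂₃, middle, P, Q, incl₁₂, Function.comp_def]
  rw [key]
  refine avail_map P Q ?_ ?_ ?_ _ _ ?_ (fun _ _ => ⟨trivial, trivial⟩)
  · rintro (i | i) (j | j) h <;> simp_all [P]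
  · rintro (i | i) (j | j) h <;> simp_all [Q]
  · rintro (i | i) (j | j) h <;> simp [P, Q] at h
  · rw [List.nodup_append]
    refine ⟨(List.nodup_finRange n).map Sum.inl_injective,
      (List.nodup_finRange n).map Sum.inr_injective, ?_⟩
    simp

theorem emb_left' : Emb outer₁₂ (loops x y) (concat (comp x y) z)
    (((juxtapose₃ x y z).glueList (middle₁₂ n)).glueList (middle₂₃ n)) := by
  have h := (emb_left x y z).glueList outer₁₂_injective (middle n)
  have e : (middle n).map (Prod.map outer₁₂ outer₁₂) = middle₂₃ n := by
    simp [middle₂₃, middle, outer₁₂, incl₁₂, outer]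
  rw [e] at h
  exact h

theorem emb_right' : Emb outer₂₃ (loops y z) (concat x (comp y z))
    (((juxtapose₃ x y z).glueList (middle₁₂ n)).glueList (middle₂₃ n)) := by
  rw [glue_both]
  have h := (emb_right x y z).glueList outer₂₃_injective (middle n)
  have e : (middle n).map (Prod.map outer₂₃ outer₂₃) = middle₁₂ n := by
    simp [middle₁₂, middle, outer₂₃, incl₁₂, outer]
  rw [e] at h
  exact h

theorem outer_outer (v : Node n) : outer₁₂ (outer v) = outer₂₃ (outer v) := by
  rcases v with v | v <;> rfl

theorem comp_assoc : comp (comp x y) z = comp x (comp y z) := by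
  ext v
  · apply outer_injective
    apply outer₁₂_injective
    rw [outer_comp_mate, ← (emb_left' x y z).mate, outer_outer, outer_outer, outer_comp_mate,
      ← (emb_right' x y z).mate]
  · show (concat (comp x y) z).label (outer v) = (concat x (comp y z)).label (outer v)
    rw [← (emb_left' x y z).label, outer_outer, (emb_right' x y z).label]

theorem loops_cocycle :
    loops x y + loops (comp x y) z = loops y z + loops x (comp y z) := by
  have h1 := (emb_left' x y z).loops
  have h2 := (emb_right' x y z).loops
  exact h1.symm.trans h2

end assoc
end BrauerDiagram

namespace LabelledGraph

variable {G V W : Type*} [CommGroup G] [DecidableEq V] [DecidableEq W]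

theorem Live.glue_symm {S : Set V} {D : LabelledGraph G V} (h : Live S D) {p q : V}
    (hpq : p ≠ q) : D.glue p q = D.glue q p := by
  obtain ⟨h1, h2, h3, h4, h5, h6⟩ := h
  ext a
  · simp only [LabelledGraph.glue]
    grind
  · simp only [LabelledGraph.glue]
    grind
  · simp only [LabelledGraph.glue]
    grind

/-- Gluing on an edge with label `1` replaces an end `f v` of an edge by the other end `p₀`. -/
theorem Emb.glue_update {f : V → W} {T : Multiset G} {D : LabelledGraph G V}
    {E : LabelledGraph G W} (hf : Function.Injective f) (h : Emb f T D E) (hD : ∀ v, D.mate v ≠ v)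
    {p p₀ : W} (v : V) (hp : ∀ a, f a ≠ p) (hp₀ : ∀ a, f a ≠ p₀) (hpp : p₀ ≠ p)
    (h1 : E.mate p = p₀) (h2 : E.mate p₀ = p) (h3 : E.label p = 1) (h4 : E.label p₀ = 1) :
    Emb (Function.update f v p₀) T D (E.glue p (f v)) := by
  obtain ⟨m, l, lo⟩ := h
  have hm : ∀ a, E.mate (f a) ≠ p := fun a => by rw [m]; exact hp _
  constructor
  · intro a
    by_cases ha : a = v
    · subst ha
      have := hp₀ a
      have := hp (D.mate a)
      simp [LabelledGraph.glue, Function.update_of_ne (hD a), h2, hpp, m, Ne.symm (hp₀ a)]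
    · simp only [LabelledGraph.glue, Function.update_of_ne ha, m, hp, hf.eq_iff, ha, h1,
        false_or, if_false]
      by_cases hav : D.mate a = v
      · simp [hav]
      · simp [hav]
  · intro a
    by_cases ha : a = v
    · subst ha
      simp [LabelledGraph.glue, h2, h4, hpp, l, Ne.symm (hp₀ a)]
    · simp only [LabelledGraph.glue, Function.update_of_ne ha, m, l, hp, hf.eq_iff, ha, h3,
        false_or, if_false, mul_one, ite_self]
  · simp [LabelledGraph.glue, h1, lo, Ne.symm (hp₀ v)]

end LabelledGraph

namespace BrauerDiagram

variable {G : Type*} [CommGroup G] {n : ℕ}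

/-- A diagram as a labelled graph. -/
def toGraph (x : BrauerDiagram G n) : LabelledGraph G (Node n) := ⟨x.mate, x.label, 0⟩

theorem concat_one_aux (x : BrauerDiagram G n) (o m : Fin n → Node n ⊕ Node n)
    (c : Fin n → Node n) (hom : ∀ i j, o i ≠ m j)
    (hm : Function.Injective m) (ho : Function.Injective o) :
    ∀ (L : List (Fin n)), L.Nodup → ∀ (f : Node n → Node n ⊕ Node n)
      (E : LabelledGraph G (Node n ⊕ Node n)), Function.Injective f → Emb f 0 x.toGraph E →
      (∀ i ∈ L, (∀ a, f a ≠ m i) ∧ (∀ a, f a ≠ o i) ∧ E.mate (m i) = o i ∧ E.mate (o i) = m i ∧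
        E.label (m i) = 1 ∧ E.label (o i) = 1) → Function.Injective c →
      ∃ f' : Node n → Node n ⊕ Node n, Emb f' 0 x.toGraph
          (E.glueList (L.map fun i => (m i, f (c i)))) ∧
        (∀ i ∈ L, f' (c i) = o i) ∧ ∀ a, (∀ i ∈ L, a ≠ c i) → f' a = f a := by
  intro L
  induction L with
  | nil =>
    intro _ f E hf h _ _
    exact ⟨f, h, by simp, by simp⟩
  | cons i L ih =>
    intro hL f E hf h hE hc
    rw [List.nodup_cons] at hL
    obtain ⟨e1, e2, e3, e4, e5, e6⟩ := hE i (by simp)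
    have h' := h.glue_update hf x.mate_ne (c i) e1 e2 (hom i i)
      e3 e4 e5 e6
    have hf' : Function.Injective (Function.update f (c i) (o i)) := by
      intro a b hab
      by_cases ha : a = c i <;> by_cases hb : b = c i
      · rw [ha, hb]
      · rw [ha, Function.update_self, Function.update_of_ne hb] at hab
        exact absurd hab.symm (e2 b)
      · rw [hb, Function.update_self, Function.update_of_ne ha] at hab
        exact absurd hab (e2 a)
      · rw [Function.update_of_ne hb, Function.update_of_ne ha] at hab
        exact hf hab
    have hne : ∀ j ∈ L, j ≠ i := fun j hj hji => hL.1 (hji ▸ hj)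
    obtain ⟨f', k1, k2, k3⟩ := ih hL.2 _ _ hf' h' (by
      intro j hj
      obtain ⟨g1, g2, g3, g4, g5, g6⟩ := hE j (by simp [hj])
      have hji := hne j hj
      have n1 := hm.ne hji
      have n2 := ho.ne hji
      have n3 := hom i j
      have n4 := hom j i
      have n5 := g1 (c i)
      have n6 := g2 (c i)
      refine ⟨?_, ?_, ?_, ?_, ?_, ?_⟩
      · intro a
        by_cases ha : a = c i
        · rw [ha, Function.update_self]; exact n3
        · rw [Function.update_of_ne ha]; exact g1 a
      · intro a
        by_cases ha : a = c i
        · rw [ha, Function.update_self]; exact n2.symm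
        · rw [Function.update_of_ne ha]; exact g2 a
      · simp [LabelledGraph.glue, n1, n5.symm, g3, n4, n6.symm]
      · simp [LabelledGraph.glue, n4, n6.symm, g4, n1, n5.symm]
      · simp [LabelledGraph.glue, n1, n5.symm, g3, n4, n6.symm, g5]
      · simp [LabelledGraph.glue, n4, n6.symm, g4, n1, n5.symm, g6]) hc
    refine ⟨f', ?_, ?_, ?_⟩
    · have e : (L.map fun j => (m j, Function.update f (c i) (o i) (c j))) =
          L.map fun j => (m j, f (c j)) := by
        refine List.map_congr_left fun j hj => ?_
        rw [Function.update_of_ne (hc.ne (hne j hj))]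
      rw [e] at k1
      exact k1
    · intro j hj
      rcases List.mem_cons.1 hj with rfl | hj
      · rw [k3 _ (fun l hl => hc.ne (hne l hl).symm), Function.update_self]
      · exact k2 j hj
    · intro a ha
      rw [k3 a (fun l hl => ha l (by simp [hl])), Function.update_of_ne (ha i (by simp))]

theorem emb_one_left (x : BrauerDiagram G n) :
    Emb outer 0 x.toGraph (concat (one G n) x) := by
  obtain ⟨f', h1, h2, h3⟩ := concat_one_aux x (fun i => Sum.inl (Sum.inl i))
    (fun i => Sum.inl (Sum.inr i)) Sum.inl (by simp) (fun i j h => by simpa using h)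
    (fun i j h => by simpa using h) (List.finRange n) (List.nodup_finRange n) Sum.inr
    (juxtapose (one G n) x) Sum.inr_injective
    ⟨by simp [juxtapose, toGraph], by simp [juxtapose, toGraph], by simp [juxtapose, toGraph]⟩
    (by simp [juxtapose, one]) Sum.inl_injective
  have : f' = outer := by
    funext v
    rcases v with v | v
    · exact h2 v (by simp)
    · exact h3 _ (by simp)
  rw [this] at h1
  exact h1

theorem glueList_symm {V : Type*} [DecidableEq V] (l : List (V × V)) :
    ∀ {S : Set V} {D : LabelledGraph G V}, Live S D → Avail S l →
      D.glueList (l.map Prod.swap) = D.glueList l := by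
  induction l with
  | nil => intros; rfl
  | cons e l ih =>
    rintro S D h ⟨h1, h2, h3, h4⟩
    show (D.glue e.2 e.1).glueList (l.map Prod.swap) = (D.glue e.1 e.2).glueList l
    rw [← h.glue_symm h3, ih (h.glue h1 h2 h3) h4]

theorem emb_one_right (x : BrauerDiagram G n) :
    Emb outer 0 x.toGraph (concat x (one G n)) := by
  obtain ⟨f', h1, h2, h3⟩ := concat_one_aux x (fun i => Sum.inr (Sum.inr i))
    (fun i => Sum.inr (Sum.inl i)) Sum.inr (by simp) (fun i j h => by simpa using h)
    (fun i j h => by simpa using h) (List.finRange n) (List.nodup_finRange n) Sum.inl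
    (juxtapose x (one G n)) Sum.inl_injective
    ⟨by simp [juxtapose, toGraph], by simp [juxtapose, toGraph], by simp [juxtapose, toGraph]⟩
    (by simp [juxtapose, one]) Sum.inr_injective
  have : f' = outer := by
    funext v
    rcases v with v | v
    · exact h3 _ (by simp)
    · exact h2 v (by simp)
  rw [this] at h1
  have e : ((List.finRange n).map fun i => ((Sum.inr (Sum.inl i), Sum.inl (Sum.inr i)) :
      (Node n ⊕ Node n) × (Node n ⊕ Node n))) = (middle n).map Prod.swap := by
    simp [middle]
  rw [e, glueList_symm _ (juxtapose_live _ _) middle_avail] at h1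
  exact h1

theorem one_comp (x : BrauerDiagram G n) : comp (one G n) x = x := by
  ext v
  · apply outer_injective
    rw [outer_comp_mate, (emb_one_left x).mate]
    rfl
  · exact (emb_one_left x).label v

theorem comp_one (x : BrauerDiagram G n) : comp x (one G n) = x := by
  ext v
  · apply outer_injective
    rw [outer_comp_mate, (emb_one_right x).mate]
    rfl
  · exact (emb_one_right x).label v

theorem loops_one_left (x : BrauerDiagram G n) : loops (one G n) x = 0 :=
  (emb_one_left x).loops

theorem loops_one_right (x : BrauerDiagram G n) : loops x (one G n) = 0 :=
  (emb_one_right x).loops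

/-- The diagram has no left-to-left and no right-to-right connections. -/
def IsThrough (x : BrauerDiagram G n) : Prop := ∀ v, (x.mate v).isLeft = !v.isLeft

theorem isThrough_of_left (x : BrauerDiagram G n) (h : ∀ i, (x.mate (Sum.inl i)).isLeft = false) :
    x.IsThrough := by
  have h1 : ∀ i, ∃ j, x.mate (Sum.inl i) = Sum.inr j := by
    intro i
    have := h i
    rcases hx : x.mate (Sum.inl i) with j | j
    · simp [hx] at this
    · exact ⟨j, rfl⟩
  choose g hg using h1
  have hg' : Function.Injective g := by
    intro i j hij
    have h2 := x.mate_mate (Sum.inl i)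
    rw [hg, hij, ← hg, x.mate_mate] at h2
    simpa using h2.symm
  rintro (i | j)
  · simp [hg]
  · obtain ⟨i, rfl⟩ := (Finite.surjective_of_injective hg') j
    have h2 := x.mate_mate (Sum.inl i)
    rw [hg] at h2
    rw [h2]
    rfl

theorem isThrough_of_right (x : BrauerDiagram G n)
    (h : ∀ i, (x.mate (Sum.inr i)).isLeft = true) : x.IsThrough := by
  have h1 : ∀ i, ∃ j, x.mate (Sum.inr i) = Sum.inl j := by
    intro i
    have := h i
    rcases hx : x.mate (Sum.inr i) with j | j
    · exact ⟨j, rfl⟩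
    · simp [hx] at this
  choose g hg using h1
  have hg' : Function.Injective g := by
    intro i j hij
    have h2 := x.mate_mate (Sum.inr i)
    rw [hg, hij, ← hg, x.mate_mate] at h2
    simpa using h2.symm
  rintro (j | i)
  · obtain ⟨i, rfl⟩ := (Finite.surjective_of_injective hg') j
    have h2 := x.mate_mate (Sum.inr i)
    rw [hg] at h2
    rw [h2]
    rfl
  · simp [hg]

theorem isThrough_one : (one G n).IsThrough := by
  rintro (v | v) <;> rfl

theorem IsThrough.left {x y : BrauerDiagram G n} (h : (comp x y).IsThrough) : x.IsThrough := by
  refine isThrough_of_left x fun i => ?_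
  rcases hx : x.mate (Sum.inl i) with j | j
  · exfalso
    have h1 := (glueList_untouched (middle n) (D := juxtapose x y) (a := outer (Sum.inl i)) (by
      intro e he
      simp only [middle, List.mem_map] at he
      obtain ⟨k, -, rfl⟩ := he
      simp [outer, juxtapose, hx])).1
    have h2 : outer ((comp x y).mate (Sum.inl i)) = outer (Sum.inl j) := by
      rw [outer_comp_mate]
      refine h1.trans ?_
      simp [outer, juxtapose, hx]
    have h3 := h (Sum.inl i)
    rw [outer_injective h2] at h3
    simp at h3
  · rfl

theorem IsThrough.right {x y : BrauerDiagram G n} (h : (comp x y).IsThrough) : y.IsThrough := by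
  refine isThrough_of_right y fun i => ?_
  rcases hy : y.mate (Sum.inr i) with j | j
  · rfl
  · exfalso
    have h1 := (glueList_untouched (middle n) (D := juxtapose x y) (a := outer (Sum.inr i)) (by
      intro e he
      simp only [middle, List.mem_map] at he
      obtain ⟨k, -, rfl⟩ := he
      simp [outer, juxtapose, hy])).1
    have h2 : outer ((comp x y).mate (Sum.inr i)) = outer (Sum.inr j) := by
      rw [outer_comp_mate]
      refine h1.trans ?_
      simp [outer, juxtapose, hy]
    have h3 := h (Sum.inr i)
    rw [outer_injective h2] at h3
    simp at h3

/-- The column, left or right, of a node of the double diagram in its own diagram. -/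
def side : Node n ⊕ Node n → Bool := Sum.elim Sum.isLeft Sum.isLeft

/-- Invariant of the concatenation of two diagrams without left-to-left and right-to-right
connections: an edge at a middle node leads to an outer node. -/
structure Straight (S : Set (Node n ⊕ Node n)) (D : LabelledGraph G (Node n ⊕ Node n)) :
    Prop where
  side : ∀ a ∈ S, side (D.mate a) = !side a
  outer : ∀ a ∈ S, a ∉ Set.range outer → D.mate a ∈ Set.range outer
  loops : D.loops = 0

theorem Straight.glueList (L : List (Fin n)) : L.Nodup →
    ∀ {S : Set (Node n ⊕ Node n)} {D : LabelledGraph G (Node n ⊕ Node n)}, Live S D →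
      (∀ i ∈ L, Sum.inl (Sum.inr i) ∈ S ∧ Sum.inr (Sum.inl i) ∈ S) → Straight S D →
      ∃ T, Straight T (D.glueList
        (L.map fun i => (Sum.inl (Sum.inr i), Sum.inr (Sum.inl i)))) ∧
        ∀ v, BrauerDiagram.outer v ∈ S → BrauerDiagram.outer v ∈ T := by
  induction L with
  | nil =>
    intro _ S D _ _ h
    exact ⟨S, h, fun _ h => h⟩
  | cons i L ih =>
    intro hL S D hD hS h
    rw [List.nodup_cons] at hL
    obtain ⟨hp, hq⟩ := hS i (by simp)
    set p : Node n ⊕ Node n := Sum.inl (Sum.inr i) with hpdef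
    set q : Node n ⊕ Node n := Sum.inr (Sum.inl i) with hqdef
    have hpq : p ≠ q := by simp [hpdef, hqdef]
    have hpo : p ∉ Set.range BrauerDiagram.outer := by
      rintro ⟨v | v, hv⟩ <;> simp [BrauerDiagram.outer, hpdef] at hv
    have hqo : q ∉ Set.range BrauerDiagram.outer := by
      rintro ⟨v | v, hv⟩ <;> simp [BrauerDiagram.outer, hqdef] at hv
    have hps : BrauerDiagram.side p = false := rfl
    have hqs : BrauerDiagram.side q = true := rfl
    have hD' := hD.glue hp hq hpq
    obtain ⟨s1, s2, s3⟩ := h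
    have hmp := s2 p hp hpo
    have hmq := s2 q hq hqo
    have hlive := hD
    obtain ⟨d1, d2, d3, d4, d5, d6⟩ := hD
    have hst : Straight (S \ {p, q}) (D.glue p q) := by
      constructor
      · intro a ha
        simp only [Set.mem_sdiff, Set.mem_insert_iff, Set.mem_singleton_iff] at ha
        simp only [LabelledGraph.glue]
        have e1 := s1 a ha.1
        have e2 := s1 p hp
        have e3 := s1 q hq
        split_ifs with c1 c2 c3
        · exact absurd c1 ha.2
        · rw [e3, hqs]; rw [c2, hps] at e1; exact e1
        · rw [e2, hps]; rw [c3, hqs] at e1; exact e1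
        · exact e1
      · intro a ha hao
        simp only [Set.mem_sdiff, Set.mem_insert_iff, Set.mem_singleton_iff] at ha
        simp only [LabelledGraph.glue]
        split_ifs with c1 c2 c3
        · exact absurd c1 ha.2
        · exact hmq
        · exact hmp
        · exact s2 a ha.1 hao
      · simp only [LabelledGraph.glue]
        rw [if_neg, s3]
        intro hc
        exact hqo (hc ▸ hmp)
    obtain ⟨T, hT, hT'⟩ := ih hL.2 hD' (by
      intro j hj
      have hji : j ≠ i := fun hji => hL.1 (hji ▸ hj)
      have := hS j (by simp [hj])
      simp [hpdef, hqdef, this, hji]) hst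
    refine ⟨T, hT, fun v hv => hT' v ⟨hv, ?_⟩⟩
    simp only [Set.mem_insert_iff, Set.mem_singleton_iff, not_or]
    exact ⟨fun hv => hpo ⟨v, hv⟩, fun hv => hqo ⟨v, hv⟩⟩

theorem straight_concat {x y : BrauerDiagram G n} (hx : x.IsThrough) (hy : y.IsThrough) :
    ∃ T, Straight T (concat x y) ∧ ∀ v, outer v ∈ T := by
  obtain ⟨T, hT, hT'⟩ := Straight.glueList (List.finRange n) (List.nodup_finRange n)
    (juxtapose_live x y) (fun _ _ => ⟨trivial, trivial⟩) (by
      constructor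
      · rintro (a | a) _
        · exact hx a
        · exact hy a
      · rintro ((a | a) | (a | a)) _ ha
        · exact absurd ⟨Sum.inl a, rfl⟩ ha
        · have := hx (Sum.inr a)
          rcases h : x.mate (Sum.inr a) with b | b
          · exact ⟨Sum.inl b, by simp [juxtapose, h, outer]⟩
          · simp [h] at this
        · have := hy (Sum.inl a)
          rcases h : y.mate (Sum.inl a) with b | b
          · simp [h] at this
          · exact ⟨Sum.inr b, by simp [juxtapose, h, outer]⟩
        · exact absurd ⟨Sum.inr a, rfl⟩ ha
      · rfl)
  exact ⟨T, hT, fun v => hT' v trivial⟩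

theorem IsThrough.comp {x y : BrauerDiagram G n} (hx : x.IsThrough) (hy : y.IsThrough) :
    (comp x y).IsThrough := by
  obtain ⟨T, hT, hT'⟩ := straight_concat hx hy
  intro v
  have h := hT.side (outer v) (hT' v)
  rw [← outer_comp_mate] at h
  have e : ∀ w : Node n, side (outer w) = w.isLeft := by
    rintro (w | w) <;> rfl
  rw [e, e] at h
  exact h

theorem IsThrough.loops_eq {x y : BrauerDiagram G n} (hx : x.IsThrough) (hy : y.IsThrough) :
    loops x y = 0 := by
  obtain ⟨T, hT, -⟩ := straight_concat hx hy
  exact hT.loops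

/-- The position of a node on the boundary of the strip between the two columns: down the left
column, then up the right column. -/
def pos : Node n → ℕ := Sum.elim (fun i => i) (fun i => 2 * n - 1 - i)

/-- The diagram can be drawn in the strip between the two columns without crossings: no two edges
have interlaced ends along the boundary. -/
def IsPlanar (x : BrauerDiagram G n) : Prop :=
  ∀ a b, ¬ (pos a < pos b ∧ pos b < pos (x.mate a) ∧ pos (x.mate a) < pos (x.mate b))

end BrauerDiagram

namespace LabelledGraph

variable {G V : Type*} [CommGroup G] [DecidableEq V]

/-- No two edges have interlaced ends with respect to the position function `π`. -/
def NonCrossing (π : V → ℕ) (D : LabelledGraph G V) : Prop :=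
  ∀ a b, ¬ (π a < π b ∧ π b < π (D.mate a) ∧ π (D.mate a) < π (D.mate b))

theorem NonCrossing.glue {π : V → ℕ} (hπ : Function.Injective π) {S : Set V}
    {D : LabelledGraph G V} (h : NonCrossing π D) (hD : Live S D) {p q : V} (hp : p ∈ S)
    (hq : q ∈ S) (hpq : π p < π q) (hadj : ∀ c ∈ S, ¬ (π p < π c ∧ π c < π q)) :
    NonCrossing π (D.glue p q) := by
  obtain ⟨d1, d2, d3, d4, d5, d6⟩ := hD
  have sep : ∀ c d, c ≠ d → π c ≠ π d := fun c d => hπ.ne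
  have key : ∀ c, D.mate c ≠ c → (π c < π p ∨ c = p ∨ c = q ∨ π q < π c) := by
    intro c hc
    have hcS : c ∈ S := by
      by_contra hcS
      exact hc (d5 c hcS)
    have h1 := hadj c hcS
    by_cases c1 : c = p
    · simp [c1]
    by_cases c2 : c = q
    · simp [c2]
    have h2 := sep c p c1
    have h3 := sep c q c2
    omega
  intro a b hab
  have sep' := fun c d (h : π c = π d) => hπ h
  have i1 := d3 a
  have i2 := d3 b
  have i3 := d3 p
  have i4 := d3 q
  have ka := key a
  have kb := key b
  have kma := key (D.mate a)
  have kmb := key (D.mate b)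
  have c1 := h a b
  have c2 := h p b
  have c3 := h q b
  have c4 := h a p
  have c5 := h a q
  have c6 := h (D.mate p) b
  have c7 := h (D.mate q) b
  have c8 := h b (D.mate p)
  have c9 := h b (D.mate q)
  have c10 := h a (D.mate p)
  have c11 := h a (D.mate q)
  have c12 := h p a
  have c13 := h q a
  have c14 := h (D.mate p) a
  have c15 := h (D.mate q) a
  have c16 := h b p
  have c17 := h b q
  simp only [LabelledGraph.glue] at hab
  have sP := sep (D.mate p) p
  have sQ := sep (D.mate q) q
  by_cases a1 : a = p ∨ a = q
  · simp only [a1, if_true] at hab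
    omega
  by_cases b1 : b = p ∨ b = q
  · simp only [b1, if_true] at hab
    omega
  simp only [a1, b1, if_false] at hab
  grind

end LabelledGraph

namespace BrauerDiagram

variable {G : Type*} [CommGroup G] {n : ℕ}

theorem pos_lt (v : Node n) : pos v < 2 * n := by
  rcases v with v | v <;> simp only [pos, Sum.elim_inl, Sum.elim_inr] <;> omega

theorem pos_injective : Function.Injective (pos (n := n)) := by
  rintro (a | a) (b | b) h <;> simp only [pos, Sum.elim_inl, Sum.elim_inr] at h
  · rw [Fin.ext h]
  · omega
  · omega
  · rw [Fin.ext (a := a) (b := b) (by omega)]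

/-- The position of a node on the boundary of the strip of the first diagram, followed by the
boundary of the strip of the second diagram. -/
def pos₂ : Node n ⊕ Node n → ℕ := Sum.elim pos (fun v => 2 * n + pos v)

theorem pos₂_injective : Function.Injective (pos₂ (n := n)) := by
  rintro (a | a) (b | b) h <;> simp only [pos₂, Sum.elim_inl, Sum.elim_inr] at h
  · rw [pos_injective h]
  · have := pos_lt a
    omega
  · have := pos_lt b
    omega
  · rw [pos_injective (Nat.add_left_cancel h)]

theorem nonCrossing_glueList (L : List (Fin n)) : L.Pairwise (· < ·) →
    ∀ {S : Set (Node n ⊕ Node n)} {D : LabelledGraph G (Node n ⊕ Node n)}, Live S D →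
      (∀ i ∈ L, Sum.inl (Sum.inr i) ∈ S ∧ Sum.inr (Sum.inl i) ∈ S) →
      (∀ i, Sum.inl (Sum.inr i) ∈ S → i ∈ L) → (∀ i, Sum.inr (Sum.inl i) ∈ S → i ∈ L) →
      NonCrossing pos₂ D → NonCrossing pos₂ (D.glueList
        (L.map fun i => (Sum.inl (Sum.inr i), Sum.inr (Sum.inl i)))) := by
  induction L with
  | nil =>
    intro _ S D _ _ _ _ h
    exact h
  | cons i L ih =>
    intro hL S D hD hS hS₁ hS₂ h
    rw [List.pairwise_cons] at hL
    obtain ⟨hp, hq⟩ := hS i (by simp)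
    refine ih hL.2 (hD.glue hp hq (by simp)) ?_ ?_ ?_ (h.glue pos₂_injective hD hp hq ?_ ?_)
    · intro j hj
      have := hS j (by simp [hj])
      have hji := (hL.1 j hj).ne'
      simp [this, hji]
    · intro j hj
      simp only [Set.mem_sdiff, Set.mem_insert_iff, Set.mem_singleton_iff, not_or] at hj
      rcases List.mem_cons.1 (hS₁ j hj.1) with rfl | h
      · exact absurd rfl hj.2.1
      · exact h
    · intro j hj
      simp only [Set.mem_sdiff, Set.mem_insert_iff, Set.mem_singleton_iff, not_or] at hj
      rcases List.mem_cons.1 (hS₂ j hj.1) with rfl | h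
      · exact absurd rfl hj.2.2
      · exact h
    · simp only [pos₂, pos, Sum.elim_inl, Sum.elim_inr]
      omega
    · have hle : ∀ j ∈ i :: L, i ≤ j := by
        intro j hj
        rcases List.mem_cons.1 hj with rfl | h
        · exact le_rfl
        · exact (hL.1 j h).le
      rintro ((j | j) | (j | j)) hj <;> simp only [pos₂, pos, Sum.elim_inl, Sum.elim_inr]
      · omega
      · have := Fin.le_def.1 (hle j (hS₁ j hj))
        omega
      · have := Fin.le_def.1 (hle j (hS₂ j hj))
        omega
      · omega

theorem pos₂_outer (a b : Node n) : pos₂ (outer a) < pos₂ (outer b) ↔ pos a < pos b := by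
  rcases a with a | a <;> rcases b with b | b <;>
    simp only [pos₂, outer, pos, Sum.map_inl, Sum.map_inr, Sum.elim_inl, Sum.elim_inr] <;> omega

theorem IsPlanar.comp {x y : BrauerDiagram G n} (hx : x.IsPlanar) (hy : y.IsPlanar) :
    (comp x y).IsPlanar := by
  have h0 : NonCrossing pos₂ (juxtapose x y) := by
    rintro (a | a) (b | b) <;>
      simp only [pos₂, juxtapose, Sum.map_inl, Sum.map_inr, Sum.elim_inl, Sum.elim_inr]
    · exact hx a b
    · have := pos_lt (x.mate a)
      omega
    · have := pos_lt b
      omega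
    · have := hy a b
      omega
  have h := nonCrossing_glueList (List.finRange n) (List.pairwise_lt_finRange n)
    (juxtapose_live x y) (fun _ _ => ⟨trivial, trivial⟩) (fun i _ => List.mem_finRange i)
    (fun i _ => List.mem_finRange i) h0
  intro a b
  rw [← pos₂_outer, ← pos₂_outer, ← pos₂_outer, outer_comp_mate, outer_comp_mate]
  exact h (outer a) (outer b)

theorem isPlanar_one : (one G n).IsPlanar := by
  rintro (a | a) (b | b) <;> simp only [one, pos, Sum.swap_inl, Sum.swap_inr, Sum.elim_inl,
    Sum.elim_inr] <;> omega

end BrauerDiagram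

open BrauerDiagram

/-- A `G`-Temperley-Lieb `n`-diagram is a planar `G`-Brauer `n`-diagram. -/
def TLDiagram (G : Type*) (n : ℕ) := {x : BrauerDiagram G n // x.IsPlanar}

namespace TLDiagram

variable {G : Type*} [CommGroup G] {n : ℕ} {k : Type*} [CommRing k] [MulSemiringAction G k]

/-- Composition of `G`-Temperley-Lieb diagrams. -/
def comp (x y : TLDiagram G n) : TLDiagram G n := ⟨x.1.comp y.1, x.2.comp y.2⟩

/-- The identity diagram. -/
def one (G : Type*) [CommGroup G] (n : ℕ) : TLDiagram G n := ⟨BrauerDiagram.one G n, isPlanar_one⟩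

/-- The pre-factor of a composite: each deleted loop with label `g` contributes `g • δ`. -/
def weight (δ : k) (x y : TLDiagram G n) : k := ((loops x.1 y.1).map fun g => g • δ).prod

theorem comp_assoc (x y z : TLDiagram G n) : comp (comp x y) z = comp x (comp y z) :=
  Subtype.ext (BrauerDiagram.comp_assoc x.1 y.1 z.1)

theorem one_comp (x : TLDiagram G n) : comp (one G n) x = x :=
  Subtype.ext (BrauerDiagram.one_comp x.1)

theorem comp_one (x : TLDiagram G n) : comp x (one G n) = x :=
  Subtype.ext (BrauerDiagram.comp_one x.1)

theorem weight_one_left (δ : k) (x : TLDiagram G n) : weight δ (one G n) x = 1 := by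
  have : loops (one G n).1 x.1 = 0 := loops_one_left x.1
  simp [weight, this]

theorem weight_one_right (δ : k) (x : TLDiagram G n) : weight δ x (one G n) = 1 := by
  have : loops x.1 (one G n).1 = 0 := loops_one_right x.1
  simp [weight, this]

theorem weight_cocycle (δ : k) (x y z : TLDiagram G n) :
    weight δ x y * weight δ (comp x y) z = weight δ y z * weight δ x (comp y z) := by
  have := loops_cocycle x.1 y.1 z.1
  simp only [weight, ← Multiset.prod_add, ← Multiset.map_add]
  exact congrArg (fun m => (Multiset.map (fun g => g • δ) m).prod) this

end TLDiagram

/-- The `G`-Temperley-Lieb algebra `GTL_n(δ)` over the commutative `G`-ring `k`: formal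
`k`-linear combinations of `G`-Temperley-Lieb `n`-diagrams. -/
def GTL (G : Type*) (n : ℕ) {k : Type*} [CommRing k] (_δ : k) := TLDiagram G n →₀ k

namespace GTL

variable {G : Type*} [CommGroup G] {n : ℕ} {k : Type*} [CommRing k] [MulSemiringAction G k]
  {δ : k}

noncomputable instance : AddCommGroup (GTL G n δ) :=
  inferInstanceAs (AddCommGroup (TLDiagram G n →₀ k))

noncomputable instance : Module k (GTL G n δ) :=
  inferInstanceAs (Module k (TLDiagram G n →₀ k))

/-- The diagrams form a `k`-basis of the algebra. -/
noncomputable def basis (G : Type*) (n : ℕ) {k : Type*} [CommRing k] (δ : k) :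
    Module.Basis (TLDiagram G n) k (GTL G n δ) :=
  Module.Basis.ofRepr (LinearEquiv.refl k (TLDiagram G n →₀ k))

/-- The product, as a bilinear map: the product of the diagrams `x` and `y` is their composite,
multiplied by the pre-factor that accounts for the deleted loops. -/
noncomputable def mulBilin (G : Type*) [CommGroup G] (n : ℕ) {k : Type*} [CommRing k]
    [MulSemiringAction G k] (δ : k) : GTL G n δ →ₗ[k] GTL G n δ →ₗ[k] GTL G n δ :=
  (basis G n δ).constr k fun x => (basis G n δ).constr k fun y =>
    TLDiagram.weight δ x y • basis G n δ (TLDiagram.comp x y)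

noncomputable instance : Mul (GTL G n δ) := ⟨fun a b => mulBilin G n δ a b⟩

noncomputable instance : One (GTL G n δ) := ⟨basis G n δ (TLDiagram.one G n)⟩

theorem mul_def (a b : GTL G n δ) : a * b = mulBilin G n δ a b := rfl

theorem one_def : (1 : GTL G n δ) = basis G n δ (TLDiagram.one G n) := rfl

theorem basis_mul_basis (x y : TLDiagram G n) :
    basis G n δ x * basis G n δ y = TLDiagram.weight δ x y • basis G n δ (TLDiagram.comp x y) := by
  rw [mul_def, mulBilin, Module.Basis.constr_basis, Module.Basis.constr_basis]

protected theorem mul_add (a b c : GTL G n δ) : a * (b + c) = a * b + a * c := by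
  simp only [mul_def, map_add]

protected theorem add_mul (a b c : GTL G n δ) : (a + b) * c = a * c + b * c := by
  simp only [mul_def, map_add, LinearMap.add_apply]

protected theorem smul_mul (r : k) (a b : GTL G n δ) : (r • a) * b = r • (a * b) := by
  simp only [mul_def, map_smul, LinearMap.smul_apply]

protected theorem mul_smul (r : k) (a b : GTL G n δ) : a * (r • b) = r • (a * b) := by
  simp only [mul_def, map_smul]

/-- Induction on elements of the algebra. -/
theorem induction {P : GTL G n δ → Prop} (a : GTL G n δ) (h0 : P 0)
    (hadd : ∀ a b, P a → P b → P (a + b)) (hsmul : ∀ (r : k) a, P a → P (r • a))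
    (hbasis : ∀ x, P (basis G n δ x)) : P a := by
  have ha : a ∈ Submodule.span k (Set.range (basis G n δ)) := by
    rw [(basis G n δ).span_eq]; trivial
  induction ha using Submodule.span_induction with
  | mem _ h => obtain ⟨x, rfl⟩ := h; exact hbasis x
  | zero => exact h0
  | add _ _ _ _ h1 h2 => exact hadd _ _ h1 h2
  | smul r _ _ h => exact hsmul r _ h

protected theorem zero_mul (a : GTL G n δ) : 0 * a = 0 := by
  simp only [mul_def, map_zero, LinearMap.zero_apply]

protected theorem mul_zero (a : GTL G n δ) : a * 0 = 0 := by
  simp only [mul_def, map_zero]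

protected theorem one_mul (a : GTL G n δ) : 1 * a = a := by
  induction a using induction with
  | h0 => exact GTL.mul_zero 1
  | hadd a b ha hb => rw [GTL.mul_add, ha, hb]
  | hsmul r a ha => rw [GTL.mul_smul, ha]
  | hbasis x =>
    rw [one_def, basis_mul_basis, TLDiagram.weight_one_left, TLDiagram.one_comp, one_smul]

protected theorem mul_one (a : GTL G n δ) : a * 1 = a := by
  induction a using induction with
  | h0 => exact GTL.zero_mul 1
  | hadd a b ha hb => rw [GTL.add_mul, ha, hb]
  | hsmul r a ha => rw [GTL.smul_mul, ha]
  | hbasis x =>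
    rw [one_def, basis_mul_basis, TLDiagram.weight_one_right, TLDiagram.comp_one, one_smul]

protected theorem mul_assoc (a b c : GTL G n δ) : a * b * c = a * (b * c) := by
  induction a using induction with
  | h0 => rw [GTL.zero_mul, GTL.zero_mul, GTL.zero_mul]
  | hadd a a' ha ha' => rw [GTL.add_mul, GTL.add_mul, GTL.add_mul, ha, ha']
  | hsmul r a ha => rw [GTL.smul_mul, GTL.smul_mul, GTL.smul_mul, ha]
  | hbasis x =>
    induction b using induction with
    | h0 => rw [GTL.mul_zero, GTL.zero_mul, GTL.mul_zero]
    | hadd b b' hb hb' => rw [GTL.mul_add, GTL.add_mul, GTL.add_mul, GTL.mul_add, hb, hb']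
    | hsmul r b hb => rw [GTL.mul_smul, GTL.smul_mul, GTL.smul_mul, GTL.mul_smul, hb]
    | hbasis y =>
      induction c using induction with
      | h0 => rw [GTL.mul_zero, GTL.mul_zero, GTL.mul_zero]
      | hadd c c' hc hc' => rw [GTL.mul_add, GTL.mul_add, GTL.mul_add, hc, hc']
      | hsmul r c hc => rw [GTL.mul_smul, GTL.mul_smul, GTL.mul_smul, hc]
      | hbasis z =>
        rw [basis_mul_basis, basis_mul_basis, GTL.smul_mul, GTL.mul_smul, basis_mul_basis,
          basis_mul_basis, smul_smul, smul_smul, TLDiagram.weight_cocycle, TLDiagram.comp_assoc]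

noncomputable instance : Ring (GTL G n δ) where
  __ := (inferInstance : AddCommGroup (GTL G n δ))
  mul := (· * ·)
  one := 1
  left_distrib := GTL.mul_add
  right_distrib := GTL.add_mul
  zero_mul := GTL.zero_mul
  mul_zero := GTL.mul_zero
  mul_assoc := GTL.mul_assoc
  one_mul := GTL.one_mul
  mul_one := GTL.mul_one
  neg_add_cancel := neg_add_cancel
  zsmul := fun m a => m • a

noncomputable instance : Algebra k (GTL G n δ) :=
  Algebra.ofModule GTL.smul_mul GTL.mul_smul

open Classical in
/-- The action on the trivial module: a diagram without left-to-left and right-to-right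
connections acts as `1`, all other diagrams act as `0`. -/
noncomputable def augLinear (G : Type*) [CommGroup G] (n : ℕ) {k : Type*} [CommRing k] (δ : k) :
    GTL G n δ →ₗ[k] k :=
  (basis G n δ).constr k fun x => if x.1.IsThrough then 1 else 0

open Classical in
theorem augLinear_basis (x : TLDiagram G n) :
    augLinear G n δ (basis G n δ x) = if x.1.IsThrough then 1 else 0 := by
  rw [augLinear, Module.Basis.constr_basis]

theorem augLinear_mul (a b : GTL G n δ) :
    augLinear G n δ (a * b) = augLinear G n δ a * augLinear G n δ b := by
  induction a using induction with
  | h0 => rw [GTL.zero_mul, map_zero, zero_mul]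
  | hadd a a' ha ha' => rw [GTL.add_mul, map_add, map_add, ha, ha', add_mul]
  | hsmul r a ha => rw [GTL.smul_mul, map_smul, map_smul, ha, smul_mul_assoc]
  | hbasis x =>
    induction b using induction with
    | h0 => rw [GTL.mul_zero, map_zero, mul_zero]
    | hadd b b' hb hb' => rw [GTL.mul_add, map_add, map_add, hb, hb', mul_add]
    | hsmul r b hb => rw [GTL.mul_smul, map_smul, map_smul, hb, mul_smul_comm]
    | hbasis y =>
      rw [basis_mul_basis, map_smul, augLinear_basis, augLinear_basis, augLinear_basis]
      by_cases hx : x.1.IsThrough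
      · by_cases hy : y.1.IsThrough
        · have h1 : (TLDiagram.comp x y).1.IsThrough := hx.comp hy
          have h2 : TLDiagram.weight δ x y = 1 := by
            simp [TLDiagram.weight, hx.loops_eq hy]
          simp [hx, hy, h1, h2]
        · have h1 : ¬ (TLDiagram.comp x y).1.IsThrough := fun h => hy (IsThrough.right h)
          simp [hy, h1]
      · have h1 : ¬ (TLDiagram.comp x y).1.IsThrough := fun h => hx (IsThrough.left h)
        simp [hx, h1]

/-- The homomorphism from the `G`-Temperley-Lieb algebra to `k` that defines the trivial
module. -/
noncomputable def aug (G : Type*) [CommGroup G] (n : ℕ) {k : Type*} [CommRing k]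
    [MulSemiringAction G k] (δ : k) : GTL G n δ →ₐ[k] k :=
  AlgHom.ofLinearMap (augLinear G n δ)
    (by
      rw [one_def, augLinear_basis, if_pos]
      exact isThrough_one)
    augLinear_mul

end GTL

section Tor

open CategoryTheory TensorProduct

variable (k : Type u) [CommRing k] {A : Type u} [Ring A] [Algebra k A]

/-- A module over a `k`-algebra is a `k`-module. -/
abbrev scalarModule (N : ModuleCat.{u} A) : Module k N := Module.compHom N (algebraMap k A)

attribute [local instance] scalarModule

/-- The submodule of `M ⊗ N` (tensor product over `k`) spanned by the elements
`m a ⊗ n - m ⊗ a n`. Right `A`-modules are left modules over the opposite algebra. -/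
def balancingSubmodule (M : ModuleCat.{u} Aᵐᵒᵖ) (N : ModuleCat.{u} A) :
    Submodule k (M ⊗[k] N) :=
  Submodule.span k
    {t | ∃ (m : M) (a : A) (x : N), t = (MulOpposite.op a • m) ⊗ₜ[k] x - m ⊗ₜ[k] (a • x)}

/-- A homomorphism of `A`-modules is `k`-linear. -/
def scalarMap {N N' : ModuleCat.{u} A} (f : N ⟶ N') : N →ₗ[k] N' where
  toFun := f.hom
  map_add' := map_add f.hom
  map_smul' r x := f.hom.map_smul (algebraMap k A r) x

theorem balancingSubmodule_le (M : ModuleCat.{u} Aᵐᵒᵖ) {N N' : ModuleCat.{u} A} (f : N ⟶ N') :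
    balancingSubmodule k M N ≤
      (balancingSubmodule k M N').comap ((scalarMap k f).lTensor M) := by
  rw [balancingSubmodule, Submodule.span_le]
  rintro _ ⟨m, a, x, rfl⟩
  refine Submodule.subset_span ⟨m, a, f.hom x, ?_⟩
  rw [map_sub, LinearMap.lTensor_tmul, LinearMap.lTensor_tmul]
  show _ - m ⊗ₜ[k] f.hom (a • x) = _
  rw [map_smul]
  rfl

/-- The functor `M ⊗ -` (tensor product over the `k`-algebra `A`), from left `A`-modules to
`k`-modules. -/
noncomputable def tensorFunctor (M : ModuleCat.{u} Aᵐᵒᵖ) : ModuleCat.{u} A ⥤ ModuleCat.{u} k where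
  obj N := ModuleCat.of k ((M ⊗[k] N) ⧸ balancingSubmodule k M N)
  map {N N'} f := ModuleCat.ofHom
    ((balancingSubmodule k M N).mapQ (balancingSubmodule k M N') ((scalarMap k f).lTensor M)
      (balancingSubmodule_le k M f))
  map_id N := by
    refine ModuleCat.hom_ext (Submodule.linearMap_qext _ (TensorProduct.ext' fun m x => ?_))
    rfl
  map_comp f g := by
    refine ModuleCat.hom_ext (Submodule.linearMap_qext _ (TensorProduct.ext' fun m x => ?_))
    rfl

instance (M : ModuleCat.{u} Aᵐᵒᵖ) : (tensorFunctor k M).Additive where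
  map_add {N N' f g} := by
    refine ModuleCat.hom_ext (Submodule.linearMap_qext _ (TensorProduct.ext' fun m x => ?_))
    show Submodule.Quotient.mk (m ⊗ₜ[k] (f.hom x + g.hom x)) = _
    rw [TensorProduct.tmul_add]
    rfl

/-- `Tor_i(M, N)` over the `k`-algebra `A`, as a `k`-module: the value at `N` of the `i`-th left
derived functor of `M ⊗ -`. -/
noncomputable def Tor (i : ℕ) (M : ModuleCat.{u} Aᵐᵒᵖ) (N : ModuleCat.{u} A) : ModuleCat.{u} k :=
  ((tensorFunctor k M).leftDerived i).obj N

variable {k}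

/-- The left module `k` on which `A` acts through `ε`. -/
def trivialLeft (ε : A →ₐ[k] k) : ModuleCat.{u} A :=
  letI : Module A k := Module.compHom k ε.toRingHom
  ModuleCat.of A k

/-- The right module `k` on which `A` acts through `ε`. -/
def trivialRight (ε : A →ₐ[k] k) : ModuleCat.{u} Aᵐᵒᵖ :=
  letI : Module Aᵐᵒᵖ k := Module.compHom k (ε.toRingHom.fromOpposite fun _ _ => mul_comm _ _)
  ModuleCat.of Aᵐᵒᵖ k

/-- `Tor_i(𝟙, 𝟙)` over `A`, where `𝟙` is the module `k` on which `A` acts through `ε`. -/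
noncomputable def torTrivial (ε : A →ₐ[k] k) (i : ℕ) : ModuleCat.{u} k :=
  Tor k i (trivialRight ε) (trivialLeft ε)

end Tor

/-- The augmentation of a group algebra: every group element acts as `1`. -/
noncomputable def groupAlgebraAug (k H : Type*) [CommRing k] [Group H] :
    MonoidAlgebra k H →ₐ[k] k :=
  MonoidAlgebra.lift k k H 1

end GTemperleyLieb

/-! Write `A` for the algebra `GTL G n δ` and `I` for the span of the diagrams that have a
left-to-left or right-to-right connection. `I` is a two-sided ideal. A planar diagram outside `I`
consists of horizontal labelled strands, so `A / I` is the group algebra of `G ^ n`, and both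
trivial modules come from the same augmentation.

Let `Q` be a projective resolution of the trivial module over `A`. The tensor product of the trivial
module with `Q` over `A` equals its tensor product with `Q / IQ` over the group algebra, and `Q /
IQ` is projective in each degree. It remains to see that `Q / IQ` still resolves the trivial module,
which follows once the subcomplex `IQ` is acyclic (`GTL.acyclic_nonThrough`).

Call an edge between neighbouring left-hand nodes, together with its label, a cup. By planarity
every diagram in `I` has a cup, and composing on the right preserves cups. So `I` is the sum of the
right ideals of diagrams with a given cup, and the intersections of these are the right ideals `J_S`
of diagrams with all the cups in a finite set `S`. The key point (`BrauerDiagram.exists_unit`) is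
that for `n` odd each nonzero `J_S` contains a diagram `e` with `e y = y` for all `y` in `J_S`. Then
`J_S Q = e Q`, whose homology is `e` applied to that of `Q`. For `S` nonempty it vanishes, because
`e` acts as `0` on the trivial module. A Mayer-Vietoris induction passes from the `J_S` to the sum
over any finite set of cups, and every element of `IQ` involves only finitely many cups.

The diagram `e` is a product of shifts, one for each cup. A shift carries the cup on its left, and
on its right an edge displaced by one node, so that against a diagram with the same cup it forms a
zigzag that straightens without closing a loop (`BrauerDiagram.shift_comp`,
`BrauerDiagram.loops_shift`). Since no loops occur, `δ` plays no role. A shift needs a node next to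
the cup that is free of the other cups in `S`. As `n` is odd, some left-hand node is joined to the
right column, and the cup nearest to it has such a neighbour.

For `n = 1`, tensoring with the trivial module over the group algebra is taking coinvariants, and
the bar resolution identifies Tor with group homology. -/

namespace GTemperleyLieb

/-! ### Walks through glued graphs -/

namespace LabelledGraph

variable {G V : Type*} [CommGroup G] [DecidableEq V] {S : Set V} {D : LabelledGraph G V}
  {l : List (V × V)} {a b : V} {g : G}

/-- A walk along the edges of `D` that passes from the end of an edge to the beginning of the next
through a pair of nodes in `l`; the group element is the product of the labels of the edges. -/
inductive Walk (D : LabelledGraph G V) (l : List (V × V)) : V → V → G → Prop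
  | edge (a : V) : Walk D l a (D.mate a) (D.label a)
  | step {a q b : V} {g : G} (h : (D.mate a, q) ∈ l ∨ (q, D.mate a) ∈ l) (w : Walk D l q b g) :
      Walk D l a b (D.label a * g)

theorem Walk.of_edge {a b : V} {g : G} (h1 : D.mate a = b) (h2 : D.label a = g) :
    Walk D l a b g := by
  subst h1 h2
  exact .edge a

theorem Walk.of_step {a p q b : V} {g₁ g₂ g : G} (h1 : D.mate a = p) (h2 : D.label a = g₁)
    (h : (p, q) ∈ l ∨ (q, p) ∈ l) (w : Walk D l q b g₂) (hg : g = g₁ * g₂) :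
    Walk D l a b g := by
  subst h1 h2 hg
  exact .step h w

theorem Avail.mem {l : List (V × V)} : ∀ {S : Set V}, Avail S l → ∀ e ∈ l, e.1 ∈ S ∧ e.2 ∈ S := by
  induction l with
  | nil => simp
  | cons e l ih =>
    rintro S ⟨h1, h2, h3, h4⟩ e' he'
    rcases List.mem_cons.1 he' with rfl | he'
    · exact ⟨h1, h2⟩
    · exact ⟨(ih h4 e' he').1.1, (ih h4 e' he').2.1⟩

/-- Gluing `e` merges the edges on either side of each passage through `e`, so a tail of the walk
may start at an end of `e`, which is dead in the glued graph. The last two clauses make the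
induction work there: they prepend the edge from `a'` that leads to the other end of `e`. -/
theorem Walk.glue {e : V × V} (hD : Live S D) (hl : Avail S (e :: l)) (hb : b ≠ e.1 ∧ b ≠ e.2)
    (w : Walk D (e :: l) a b g) :
    (a ≠ e.1 → a ≠ e.2 → Walk (D.glue e.1 e.2) l a b g) ∧
    (∀ a', a' ≠ e.1 → a' ≠ e.2 → a = e.2 → D.mate a' = e.1 →
      Walk (D.glue e.1 e.2) l a' b (D.label a' * g)) ∧
    (∀ a', a' ≠ e.1 → a' ≠ e.2 → a = e.1 → D.mate a' = e.2 →
      Walk (D.glue e.1 e.2) l a' b (D.label a' * g)) := by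
  obtain ⟨p, q⟩ := e
  obtain ⟨h1, h2, h3, h4⟩ := hl
  have hm := h4.mem
  have i1 := hD.invol
  have n1 := hD.ne p h1
  have n2 := hD.ne q h2
  simp only at *
  have hm' : ∀ r s, (r, s) ∈ l → r ≠ p ∧ r ≠ q ∧ s ≠ p ∧ s ≠ q := by
    intro r s hrs
    have := hm _ hrs
    simp only [Set.mem_sdiff, Set.mem_insert_iff, Set.mem_singleton_iff, not_or] at this
    exact ⟨this.1.2.1, this.1.2.2, this.2.2.1, this.2.2.2⟩
  induction w with
  | edge a =>
    refine ⟨fun ha1 ha2 => ?_, fun a' ha1 ha2 ha hma => ?_, fun a' ha1 ha2 ha hma => ?_⟩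
    · refine .of_edge ?_ ?_ <;> simp [LabelledGraph.glue, ha1, ha2, hb]
    · subst ha
      refine .of_edge ?_ ?_ <;> simp [LabelledGraph.glue, ha1, ha2, hma]
    · subst ha
      refine .of_edge ?_ ?_ <;> simp [LabelledGraph.glue, ha1, ha2, hma, h3.symm]
  | @step a q' b g hs w ih =>
    obtain ⟨ih1, ih2, ih3⟩ := ih hb
    simp only [List.mem_cons, Prod.mk.injEq] at hs
    have hi := i1 a
    refine ⟨fun ha1 ha2 => ?_, fun a' ha1 ha2 ha hma => ?_, fun a' ha1 ha2 ha hma => ?_⟩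
    · by_cases c1 : D.mate a = p
      · have : q' = q := by
          rcases hs with (⟨-, h⟩ | h) | (⟨-, h⟩ | h)
          · exact h
          · exact absurd c1 (hm' _ _ h).1
          · exact absurd (c1.symm.trans h) h3
          · exact absurd c1 (hm' _ _ h).2.2.1
        exact ih2 a ha1 ha2 this c1
      by_cases c2 : D.mate a = q
      · have : q' = p := by
          rcases hs with (⟨h, -⟩ | h) | (⟨h, -⟩ | h)
          · exact absurd h c1
          · exact absurd c2 (hm' _ _ h).2.1
          · exact h
          · exact absurd c2 (hm' _ _ h).2.2.2
        exact ih3 a ha1 ha2 this c2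
      have hs' : (D.mate a, q') ∈ l ∨ (q', D.mate a) ∈ l := by
        rcases hs with (⟨h, -⟩ | h) | (⟨-, h⟩ | h)
        · exact absurd h c1
        · exact .inl h
        · exact absurd h c2
        · exact .inr h
      have hq : q' ≠ p ∧ q' ≠ q := by
        rcases hs' with h | h <;> have := hm' _ _ h <;> tauto
      refine .of_step (p := D.mate a) ?_ ?_ hs' (ih1 hq.1 hq.2) rfl <;>
        simp [LabelledGraph.glue, ha1, ha2, c1, c2]
    · have hi' := i1 a'
      subst ha
      have hs' : (D.mate a, q') ∈ l ∨ (q', D.mate a) ∈ l := by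
        rcases hs with (⟨h, -⟩ | h) | (⟨-, h⟩ | h)
        · grind
        · exact .inl h
        · grind
        · exact .inr h
      have hq : q' ≠ p ∧ q' ≠ a := by
        rcases hs' with h | h <;> have := hm' _ _ h <;> tauto
      refine .of_step (p := D.mate a) ?_ ?_ hs' (ih1 hq.1 hq.2) (mul_assoc _ _ _).symm <;>
        simp [LabelledGraph.glue, ha1, ha2, hma]
    · have hi' := i1 a'
      subst ha
      have hs' : (D.mate a, q') ∈ l ∨ (q', D.mate a) ∈ l := by
        rcases hs with (⟨h, -⟩ | h) | (⟨-, h⟩ | h)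
        · grind
        · exact .inl h
        · grind
        · exact .inr h
      have hq : q' ≠ a ∧ q' ≠ q := by
        rcases hs' with h | h <;> have := hm' _ _ h <;> tauto
      refine .of_step (p := D.mate a) ?_ ?_ hs' (ih1 hq.1 hq.2) (mul_assoc _ _ _).symm <;>
        simp [LabelledGraph.glue, ha1, ha2, hma, h3.symm]

/-- A walk between nodes that are not glued becomes an edge. -/
theorem Walk.glueList : ∀ {l : List (V × V)} {S : Set V} {D : LabelledGraph G V}, Live S D →
    Avail S l → (∀ e ∈ l, a ≠ e.1 ∧ a ≠ e.2) → (∀ e ∈ l, b ≠ e.1 ∧ b ≠ e.2) → Walk D l a b g →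
      (D.glueList l).mate a = b ∧ (D.glueList l).label a = g := by
  intro l
  induction l with
  | nil =>
    rintro S D - - - - w
    cases w with
    | edge => exact ⟨rfl, rfl⟩
    | step h => simp at h
  | cons e l ih =>
    intro S D hD hl ha hb w
    have ha' := ha e (by simp)
    exact ih (hD.glue hl.1 hl.2.1 hl.2.2.1) hl.2.2.2 (fun e he => ha e (by simp [he]))
      (fun e he => hb e (by simp [he])) ((w.glue hD hl (hb e (by simp))).1 ha'.1 ha'.2)

/-- A walk that enters the closed loop formed by `p` and `q` can never leave it. Hence a walk that
escapes to an unglued node shows that gluing `p` to `q` closes no loop. -/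
theorem Walk.mem_of_loop {p q : V} (hD : Live S D) (hl : Avail S ((p, q) :: l))
    (hpq : D.mate p = q) (w : Walk D ((p, q) :: l) a b g) (ha : a = p ∨ a = q) :
    b = p ∨ b = q := by
  have hm := hl.2.2.2.mem
  have hm' : ∀ r s, (r, s) ∈ l → r ≠ p ∧ r ≠ q ∧ s ≠ p ∧ s ≠ q := by
    intro r s hrs
    have := hm _ hrs
    simp only [Set.mem_sdiff, Set.mem_insert_iff, Set.mem_singleton_iff, not_or] at this
    exact ⟨this.1.2.1, this.1.2.2, this.2.2.1, this.2.2.2⟩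
  have hqp : D.mate q = p := by rw [← hpq, hD.invol]
  induction w with
  | edge a => grind
  | @step a q' b g hs w ih =>
    refine ih ?_
    simp only [List.mem_cons, Prod.mk.injEq] at hs
    rcases hs with (⟨-, h⟩ | h) | (⟨h, -⟩ | h)
    · exact .inr h
    · have := hm' _ _ h
      grind
    · exact .inl h
    · have := hm' _ _ h
      grind

/-- If one can walk from each of the nodes that are glued to a node that is not glued, then no
loops are formed. -/
theorem glueList_loops_of_walk : ∀ {l : List (V × V)} {S : Set V} {D : LabelledGraph G V},
    Live S D → Avail S l →
    (∀ a, (∃ e ∈ l, a = e.1 ∨ a = e.2) → ∃ b g, (∀ e ∈ l, b ≠ e.1 ∧ b ≠ e.2) ∧ Walk D l a b g) →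
      (D.glueList l).loops = D.loops := by
  intro l
  induction l with
  | nil => intros; rfl
  | cons e l ih =>
    intro S D hD hl h
    have hne : D.mate e.1 ≠ e.2 := by
      intro hpq
      obtain ⟨b, g, hb, w⟩ := h e.1 ⟨e, by simp, .inl rfl⟩
      have := hb e (by simp)
      have := w.mem_of_loop hD hl hpq (.inl rfl)
      tauto
    have h1 : (D.glue e.1 e.2).loops = D.loops := by simp [LabelledGraph.glue, hne]
    rw [← h1]
    refine ih (hD.glue hl.1 hl.2.1 hl.2.2.1) hl.2.2.2 ?_
    intro a ha
    obtain ⟨b, g, hb, w⟩ := h a (by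
      obtain ⟨e', he', h'⟩ := ha
      exact ⟨e', by simp [he'], h'⟩)
    refine ⟨b, g, fun e he => hb e (by simp [he]), (w.glue hD hl (hb e (by simp))).1 ?_ ?_⟩ <;>
    · obtain ⟨e', he', h'⟩ := ha
      have := hl.2.2.2.mem e' he'
      simp only [Set.mem_sdiff, Set.mem_insert_iff, Set.mem_singleton_iff, not_or] at this
      rcases h' with rfl | rfl <;> tauto

end LabelledGraph

end GTemperleyLieb

/-! ### Computing composites of diagrams by walks -/

namespace GTemperleyLieb

open LabelledGraph

namespace BrauerDiagram

variable {G : Type*} [CommGroup G] {n : ℕ}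

theorem outer_ne_middle (v : Node n) : ∀ e ∈ middle n, outer v ≠ e.1 ∧ outer v ≠ e.2 := by
  intro e he
  simp only [middle, List.mem_map] at he
  obtain ⟨i, -, rfl⟩ := he
  rcases v with v | v <;> simp [outer]

theorem mem_middle (i : Fin n) :
    ((Sum.inl (Sum.inr i), Sum.inr (Sum.inl i)) : (Node n ⊕ Node n) × (Node n ⊕ Node n)) ∈
      middle n := by
  simp [middle]

/-- A walk in the two diagrams `x` and `y`, placed side by side. -/
abbrev CompWalk (x y : BrauerDiagram G n) (a b : Node n ⊕ Node n) (g : G) : Prop :=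
  Walk (juxtapose x y) (middle n) a b g

section walk

variable {x y : BrauerDiagram G n} {v w : Node n} {i : Fin n} {b : Node n ⊕ Node n} {g g₁ g₂ : G}

theorem CompWalk.left (h1 : x.mate v = w) (h2 : x.label v = g) :
    CompWalk x y (Sum.inl v) (Sum.inl w) g :=
  .of_edge (by simp [juxtapose, h1]) (by simp [juxtapose, h2])

theorem CompWalk.right (h1 : y.mate v = w) (h2 : y.label v = g) :
    CompWalk x y (Sum.inr v) (Sum.inr w) g :=
  .of_edge (by simp [juxtapose, h1]) (by simp [juxtapose, h2])

theorem CompWalk.left_step (h1 : x.mate v = Sum.inr i) (h2 : x.label v = g₁)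
    (h : CompWalk x y (Sum.inr (Sum.inl i)) b g₂) (hg : g = g₁ * g₂) :
    CompWalk x y (Sum.inl v) b g :=
  .of_step (by simp [juxtapose, h1]) (by simp [juxtapose, h2]) (.inl (mem_middle i)) h hg

theorem CompWalk.right_step (h1 : y.mate v = Sum.inl i) (h2 : y.label v = g₁)
    (h : CompWalk x y (Sum.inl (Sum.inr i)) b g₂) (hg : g = g₁ * g₂) :
    CompWalk x y (Sum.inr v) b g :=
  .of_step (by simp [juxtapose, h1]) (by simp [juxtapose, h2]) (.inr (mem_middle i)) h hg

/-- This reduces the computation of a composite to exhibiting, for each outer node, the path that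
starts there; the iterated gluing need not be unfolded. -/
theorem comp_of_walk (h : CompWalk x y (outer v) (outer w) g) :
    (comp x y).mate v = w ∧ (comp x y).label v = g := by
  have := h.glueList (juxtapose_live x y) middle_avail (outer_ne_middle v) (outer_ne_middle w)
  refine ⟨outer_injective ?_, this.2⟩
  rw [outer_comp_mate]
  exact this.1

theorem loops_of_walk (h1 : ∀ i, ∃ v g, CompWalk x y (Sum.inl (Sum.inr i)) (outer v) g)
    (h2 : ∀ i, ∃ v g, CompWalk x y (Sum.inr (Sum.inl i)) (outer v) g) : loops x y = 0 := by
  refine glueList_loops_of_walk (juxtapose_live x y) middle_avail ?_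
  rintro a ⟨e, he, ha⟩
  simp only [middle, List.mem_map] at he
  obtain ⟨i, -, rfl⟩ := he
  rcases ha with rfl | rfl
  · obtain ⟨v, g, h⟩ := h1 i
    exact ⟨_, _, outer_ne_middle v, h⟩
  · obtain ⟨v, g, h⟩ := h2 i
    exact ⟨_, _, outer_ne_middle v, h⟩

end walk

/-! ### Diagrams of horizontal strands -/

/-- The diagram with `n` horizontal edges, labelled by the components of `g`. -/
def strands (g : Fin n → G) : BrauerDiagram G n where
  mate := Sum.swap
  label := Sum.elim g g
  mate_mate v := Sum.swap_swap v
  mate_ne v := by rcases v with v | v <;> simp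
  label_mate v := by rcases v with v | v <;> rfl

theorem strands_one : strands (1 : Fin n → G) = one G n := by
  ext v
  · rfl
  · rcases v with v | v <;> rfl

theorem isThrough_strands (g : Fin n → G) : (strands g).IsThrough := by
  rintro (v | v) <;> rfl

theorem isPlanar_strands (g : Fin n → G) : (strands g).IsPlanar := by
  rintro (a | a) (b | b) <;> simp only [strands, pos, Sum.swap_inl, Sum.swap_inr, Sum.elim_inl,
    Sum.elim_inr] <;> omega

theorem strands_comp (g h : Fin n → G) : comp (strands g) (strands h) = strands (g * h) := by
  have key : ∀ v, CompWalk (strands g) (strands h) (outer v) (outer v.swap)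
      ((strands (g * h)).label v) := by
    rintro (v | v)
    · exact .left_step (i := v) (g₂ := h v) rfl rfl (.right rfl rfl) rfl
    · exact .right_step (i := v) (g₂ := g v) rfl rfl (.left rfl rfl) (mul_comm _ _)
  ext v
  · exact (comp_of_walk (key v)).1
  · exact (comp_of_walk (key v)).2

/-- Two planar edges from left to right do not cross. -/
theorem IsPlanar.lt_of_lt {x : BrauerDiagram G n} (hx : x.IsPlanar) {i j i' j' : Fin n}
    (hi : x.mate (Sum.inl i) = Sum.inr i') (hj : x.mate (Sum.inl j) = Sum.inr j') (hij : i < j) :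
    i' < j' := by
  have h := hx (Sum.inl i) (Sum.inl j)
  have hne : i' ≠ j' := by
    rintro rfl
    have := congrArg x.mate (hi.trans hj.symm)
    rw [x.mate_mate, x.mate_mate] at this
    exact hij.ne (by simpa using this)
  rw [hi, hj] at h
  simp only [pos, Sum.elim_inl, Sum.elim_inr] at h
  have hij' : (i : ℕ) < j := hij
  have : (i' : ℕ) ≠ j' := fun h => hne (Fin.ext h)
  show (i' : ℕ) < j'
  omega

/-- Planarity makes the matching of the left with the right column increasing, and the only
increasing bijection of `Fin n` with itself is the identity. -/
theorem eq_strands {x : BrauerDiagram G n} (hx : x.IsPlanar) (hx' : x.IsThrough) :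
    ∃ g : Fin n → G, x = strands g := by
  have h1 : ∀ i, ∃ j, x.mate (Sum.inl i) = Sum.inr j := by
    intro i
    have := hx' (Sum.inl i)
    rcases hi : x.mate (Sum.inl i) with j | j
    · simp [hi] at this
    · exact ⟨j, rfl⟩
  choose f hf using h1
  have hmono : StrictMono f := fun i j hij => hx.lt_of_lt (hf i) (hf j) hij
  have hid : f = id := by
    have h2 : Function.Surjective f := Finite.surjective_of_injective hmono.injective
    -- A finite linear order has only one order automorphism.
    have := Subsingleton.elim (StrictMono.orderIsoOfSurjective f hmono h2) (OrderIso.refl _)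
    funext i
    exact congrArg (fun e : Fin n ≃o Fin n => e i) this
  subst hid
  have hl : ∀ v, x.mate v = v.swap := by
    rintro (v | v)
    · exact hf v
    · rw [Sum.swap_inr, ← x.mate_mate (Sum.inl v), hf v]
      rfl
  refine ⟨fun i => x.label (Sum.inl i), ?_⟩
  ext v
  · exact hl v
  · rcases v with v | v
    · rfl
    · rw [← x.label_mate, hl]
      rfl

/-- An edge between left-hand nodes of `x` survives in `comp x y`. -/
theorem comp_mate_left {x : BrauerDiagram G n} (y : BrauerDiagram G n) {i j : Fin n} {g : G}
    (h1 : x.mate (Sum.inl i) = Sum.inl j) (h2 : x.label (Sum.inl i) = g) :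
    (comp x y).mate (Sum.inl i) = Sum.inl j ∧ (comp x y).label (Sum.inl i) = g :=
  comp_of_walk (v := Sum.inl i) (w := Sum.inl j) (CompWalk.left h1 h2)

/-! ### Shifts: straightening a zigzag -/

/-- The diagram with an edge between the left-hand nodes `a` and `b`, an edge between the
right-hand nodes `b` and `c`, and an edge from the left-hand node `c` to the right-hand node `a`;
the other edges are horizontal. -/
def shift (a b c : Fin n) (hab : a ≠ b) (hbc : b ≠ c) (hac : a ≠ c) (g : G) :
    BrauerDiagram G n where
  mate := Sum.elim
    (fun v => if v = a then Sum.inl b else if v = b then Sum.inl a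
      else if v = c then Sum.inr a else Sum.inr v)
    (fun v => if v = b then Sum.inr c else if v = c then Sum.inr b
      else if v = a then Sum.inl c else Sum.inl v)
  label := Sum.elim
    (fun v => if v = a then g else if v = b then g else if v = c then g⁻¹ else 1)
    (fun v => if v = a then g⁻¹ else 1)
  mate_mate v := by
    rcases v with v | v <;> simp only [Sum.elim_inl, Sum.elim_inr] <;> split_ifs <;>
      simp_all [hac.symm, hbc.symm]
  mate_ne v := by
    rcases v with v | v <;> simp only [Sum.elim_inl, Sum.elim_inr] <;> split_ifs <;>
      simp_all [eq_comm]
  label_mate v := by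
    rcases v with v | v <;> simp only [Sum.elim_inl, Sum.elim_inr] <;> split_ifs <;>
      simp_all [eq_comm]

section shift

variable {a b c : Fin n} {hab : a ≠ b} {hbc : b ≠ c} {hac : a ≠ c} {g : G}

local notation "σ" => shift a b c hab hbc hac g

theorem shift_mate_inl_fst : (σ).mate (Sum.inl a) = Sum.inl b := by simp [shift]

theorem shift_mate_inl_snd : (σ).mate (Sum.inl b) = Sum.inl a := by simp [shift, hab.symm]

theorem shift_mate_inl_trd : (σ).mate (Sum.inl c) = Sum.inr a := by
  simp [shift, hbc.symm, hac.symm]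

theorem shift_mate_inl {v : Fin n} (h1 : v ≠ a) (h2 : v ≠ b) (h3 : v ≠ c) :
    (σ).mate (Sum.inl v) = Sum.inr v := by simp [shift, h1, h2, h3]

theorem shift_mate_inr_fst : (σ).mate (Sum.inr a) = Sum.inl c := by
  simp [shift, hab, hac]

theorem shift_mate_inr_snd : (σ).mate (Sum.inr b) = Sum.inr c := by simp [shift]

theorem shift_mate_inr_trd : (σ).mate (Sum.inr c) = Sum.inr b := by simp [shift, hbc.symm]

theorem shift_mate_inr {v : Fin n} (h1 : v ≠ a) (h2 : v ≠ b) (h3 : v ≠ c) :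
    (σ).mate (Sum.inr v) = Sum.inl v := by simp [shift, h1, h2, h3]

theorem shift_label_inl_fst : (σ).label (Sum.inl a) = g := by simp [shift]

theorem shift_label_inl_snd : (σ).label (Sum.inl b) = g := by simp [shift]

theorem shift_label_inl_trd : (σ).label (Sum.inl c) = g⁻¹ := by
  simp [shift, hbc.symm, hac.symm]

theorem shift_label_inl {v : Fin n} (h1 : v ≠ a) (h2 : v ≠ b) (h3 : v ≠ c) :
    (σ).label (Sum.inl v) = 1 := by simp [shift, h1, h2, h3]

theorem shift_label_inr_fst : (σ).label (Sum.inr a) = g⁻¹ := by simp [shift]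

theorem shift_label_inr {v : Fin n} (h1 : v ≠ a) : (σ).label (Sum.inr v) = 1 := by
  simp [shift, h1]

variable {y : BrauerDiagram G n}

/-- For `w = c` the path runs along the right-hand edge from `c` to `b`, back along the cup of `y`
from `b` to `a`, and out along the strand from `a` to `c`. The labels `1`, `g`, `g⁻¹` cancel; this
is why the strand of the shift carries `g⁻¹`. -/
theorem compWalk_shift_middle (h1 : y.mate (Sum.inl a) = Sum.inl b)
    (h2 : y.label (Sum.inl a) = g) {w : Fin n} (hwa : w ≠ a) (hwb : w ≠ b) :
    CompWalk σ y (Sum.inl (Sum.inr w)) (outer (Sum.inl w)) 1 := by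
  have h3 : y.mate (Sum.inl b) = Sum.inl a := by rw [← h1, y.mate_mate]
  have h4 : y.label (Sum.inl b) = g := by rw [← h1, y.label_mate, h2]
  by_cases hwc : w = c
  · subst hwc
    exact .left_step shift_mate_inr_trd (shift_label_inr hwa)
      (.right_step h3 h4 (.left shift_mate_inr_fst shift_label_inr_fst) rfl) (by simp)
  · exact .left (shift_mate_inr hwa hwb hwc) (shift_label_inr hwa)

/-- Away from its cup, an edge of `y` that ends in the left column ends at a middle node other than
`a` and `b`, from which the shift leads to the outer node of the same index with label `1`. -/
theorem compWalk_shift_of_left (h1 : y.mate (Sum.inl a) = Sum.inl b)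
    (h2 : y.label (Sum.inl a) = g) {v : Node n} (hva : v ≠ Sum.inl a) (hvb : v ≠ Sum.inl b) :
    CompWalk σ y (Sum.inr v) (outer (y.mate v)) (y.label v) := by
  have h3 : y.mate (Sum.inl b) = Sum.inl a := by rw [← h1, y.mate_mate]
  rcases hw : y.mate v with w | w
  · refine .right_step hw rfl (compWalk_shift_middle h1 h2 ?_ ?_) (mul_one _).symm
    · rintro rfl
      rw [← h3] at hw
      apply hvb
      have := congrArg y.mate hw
      rwa [y.mate_mate, y.mate_mate] at this
    · rintro rfl
      rw [← h1] at hw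
      apply hva
      have := congrArg y.mate hw
      rwa [y.mate_mate, y.mate_mate] at this
  · exact .right hw rfl

theorem compWalk_shift_outer (h1 : y.mate (Sum.inl a) = Sum.inl b)
    (h2 : y.label (Sum.inl a) = g) (v : Node n) :
    CompWalk σ y (outer v) (outer (y.mate v)) (y.label v) := by
  have h3 : y.mate (Sum.inl b) = Sum.inl a := by rw [← h1, y.mate_mate]
  have h4 : y.label (Sum.inl b) = g := by rw [← h1, y.label_mate, h2]
  rcases v with v | v
  · by_cases hva : v = a
    · subst hva
      rw [h1, h2]
      exact .left shift_mate_inl_fst shift_label_inl_fst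
    by_cases hvb : v = b
    · subst hvb
      rw [h3, h4]
      exact .left shift_mate_inl_snd shift_label_inl_snd
    have hy := compWalk_shift_of_left (hab := hab) (hbc := hbc) (hac := hac) h1 h2
      (v := Sum.inl v) (by simpa using hva) (by simpa using hvb)
    by_cases hvc : v = c
    · subst hvc
      -- The zigzag: along the strand from `c` to `a`, the cup of `y` from `a` to `b`, and the
      -- right-hand edge from `b` to `c`, with total label `g⁻¹ * g * 1`, after which the path
      -- follows the edge of `y` at `c`.
      exact .left_step shift_mate_inl_trd shift_label_inl_trd
        (.right_step h1 h2 (.left_step shift_mate_inr_snd (shift_label_inr hab.symm) hy rfl) rfl)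
        (by simp)
    · exact .left_step (shift_mate_inl hva hvb hvc) (shift_label_inl hva hvb hvc) hy
        (one_mul _).symm
  · exact compWalk_shift_of_left h1 h2 (by simp) (by simp)

theorem shift_comp (h1 : y.mate (Sum.inl a) = Sum.inl b) (h2 : y.label (Sum.inl a) = g) :
    comp σ y = y := by
  ext v
  · exact (comp_of_walk (compWalk_shift_outer h1 h2 v)).1
  · exact (comp_of_walk (compWalk_shift_outer h1 h2 v)).2

/-- From every middle node one can walk to the outside: those of index `a`, `b`, `c` all lie on the
zigzag, the others on continued edges of `y`. So the pre-factor is `1` whatever `δ` is. -/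
theorem loops_shift (h1 : y.mate (Sum.inl a) = Sum.inl b) (h2 : y.label (Sum.inl a) = g) :
    loops σ y = 0 := by
  have h3 : y.mate (Sum.inl b) = Sum.inl a := by rw [← h1, y.mate_mate]
  have hc := compWalk_shift_of_left (hab := hab) (hbc := hbc) (hac := hac) h1 h2
      (v := Sum.inl c) (by simpa using hac.symm) (by simpa using hbc.symm)
  refine loops_of_walk (fun w => ?_) (fun w => ?_)
  · by_cases hwa : w = a
    · subst hwa
      exact ⟨Sum.inl c, _, .left shift_mate_inr_fst rfl⟩
    by_cases hwb : w = b
    · subst hwb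
      exact ⟨_, _, .left_step shift_mate_inr_snd rfl hc rfl⟩
    exact ⟨_, _, compWalk_shift_middle h1 h2 hwa hwb⟩
  · by_cases hwa : w = a
    · subst hwa
      exact ⟨_, _, .right_step h1 rfl (.left_step shift_mate_inr_snd rfl hc rfl) rfl⟩
    by_cases hwb : w = b
    · subst hwb
      exact ⟨Sum.inl c, _, .right_step h3 rfl (.left shift_mate_inr_fst rfl) rfl⟩
    exact ⟨_, _, compWalk_shift_of_left h1 h2 (by simpa using hwa) (by simpa using hwb)⟩

/-- An edge between left-hand nodes other than `a`, `b`, `c` survives in the composite. -/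
theorem shift_comp_mate_left {i j : Fin n} {h : G} (h1 : y.mate (Sum.inl i) = Sum.inl j)
    (h2 : y.label (Sum.inl i) = h) (hia : i ≠ a) (hib : i ≠ b) (hic : i ≠ c) (hja : j ≠ a)
    (hjb : j ≠ b) (hjc : j ≠ c) :
    (comp σ y).mate (Sum.inl i) = Sum.inl j ∧ (comp σ y).label (Sum.inl i) = h :=
  comp_of_walk (v := Sum.inl i) (w := Sum.inl j)
    (.left_step (shift_mate_inl hia hib hic) (shift_label_inl hia hib hic)
      (.right_step h1 h2 (.left (shift_mate_inr hja hjb hjc) (shift_label_inr hja)) rfl)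
      (by simp))

/-- The spare node `c` lies directly below the cup here, and directly above it in
`isPlanar_shift_down`. Which form applies depends on the side on which a free node is available. -/
theorem isPlanar_shift_up (h1 : (b : ℕ) = a + 1) (h2 : (c : ℕ) = a + 2) : (σ).IsPlanar := by
  -- With the boundary positions written as explicit functions of natural numbers, planarity becomes
  -- a finite case check in linear arithmetic.
  have hp : ∀ v : Node n, pos ((σ).mate v) = Sum.elim
      (fun v : Fin n => if (v : ℕ) = a then (a : ℕ) + 1 else if (v : ℕ) = a + 1 then (a : ℕ)
        else if (v : ℕ) = a + 2 then 2 * n - 1 - a else 2 * n - 1 - v)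
      (fun v : Fin n => if (v : ℕ) = a + 1 then 2 * n - 1 - (a + 2)
        else if (v : ℕ) = a + 2 then 2 * n - 1 - (a + 1)
        else if (v : ℕ) = a then (a : ℕ) + 2 else (v : ℕ)) v := by
    rintro (v | v) <;> simp only [shift, Sum.elim_inl, Sum.elim_inr, Fin.ext_iff, h1, h2] <;>
      split_ifs <;> simp [pos, h1, h2]
  rintro (v | v) (w | w) <;> rw [hp, hp] <;> simp only [pos, Sum.elim_inl, Sum.elim_inr] <;>
    split_ifs <;> omega

theorem isPlanar_shift_down (h1 : (a : ℕ) = c + 2) (h2 : (b : ℕ) = c + 1) : (σ).IsPlanar := by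
  have hp : ∀ v : Node n, pos ((σ).mate v) = Sum.elim
      (fun v : Fin n => if (v : ℕ) = c + 2 then (c : ℕ) + 1 else if (v : ℕ) = c + 1 then (c : ℕ) + 2
        else if (v : ℕ) = c then 2 * n - 1 - (c + 2) else 2 * n - 1 - v)
      (fun v : Fin n => if (v : ℕ) = c + 1 then 2 * n - 1 - c
        else if (v : ℕ) = c then 2 * n - 1 - (c + 1)
        else if (v : ℕ) = c + 2 then (c : ℕ) else (v : ℕ)) v := by
    rintro (v | v) <;> simp only [shift, Sum.elim_inl, Sum.elim_inr, Fin.ext_iff, h1, h2] <;>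
      split_ifs <;> simp [pos, h1, h2]
  rintro (v | v) (w | w) <;> rw [hp, hp] <;> simp only [pos, Sum.elim_inl, Sum.elim_inr] <;>
    split_ifs <;> omega

end shift

end BrauerDiagram

end GTemperleyLieb

/-! ### Cups, and left units for diagrams with prescribed cups -/

namespace GTemperleyLieb

open LabelledGraph

namespace BrauerDiagram

variable {G : Type*} [CommGroup G] {n : ℕ}

/-- The diagram has an edge labelled by `c.2` between the neighbouring left-hand nodes `c.1` and
`c.1 + 1`. -/
def HasCup (x : BrauerDiagram G n) (c : ℕ × G) : Prop :=
  ∃ i j : Fin n, (i : ℕ) = c.1 ∧ (j : ℕ) = c.1 + 1 ∧ x.mate (Sum.inl i) = Sum.inl j ∧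
    x.label (Sum.inl i) = c.2

theorem HasCup.mate_fst {x : BrauerDiagram G n} {c : ℕ × G} (h : x.HasCup c) {i : Fin n}
    (hi : (i : ℕ) = c.1) : ∃ j : Fin n, (j : ℕ) = c.1 + 1 ∧ x.mate (Sum.inl i) = Sum.inl j ∧
      x.label (Sum.inl i) = c.2 := by
  obtain ⟨i', j, h1, h2, h3, h4⟩ := h
  obtain rfl : i = i' := Fin.ext (by omega)
  exact ⟨j, h2, h3, h4⟩

theorem HasCup.mate_snd {x : BrauerDiagram G n} {c : ℕ × G} (h : x.HasCup c) {j : Fin n}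
    (hj : (j : ℕ) = c.1 + 1) : ∃ i : Fin n, (i : ℕ) = c.1 ∧ x.mate (Sum.inl j) = Sum.inl i ∧
      x.label (Sum.inl j) = c.2 := by
  obtain ⟨i, j', h1, h2, h3, h4⟩ := h
  obtain rfl : j = j' := Fin.ext (by omega)
  exact ⟨i, h1, by rw [← h3, x.mate_mate], by rw [← h3, x.label_mate, h4]⟩

theorem HasCup.comp {x : BrauerDiagram G n} {c : ℕ × G} (h : x.HasCup c) (y : BrauerDiagram G n) :
    (comp x y).HasCup c := by
  obtain ⟨i, j, h1, h2, h3, h4⟩ := h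
  exact ⟨i, j, h1, h2, comp_mate_left y h3 h4⟩

theorem HasCup.not_isThrough {x : BrauerDiagram G n} {c : ℕ × G} (h : x.HasCup c) :
    ¬ x.IsThrough := by
  obtain ⟨i, j, h1, h2, h3, h4⟩ := h
  intro hx
  have := hx (Sum.inl i)
  simp [h3] at this

/-- Two cups of a diagram are equal or disjoint. -/
theorem HasCup.disjoint {x : BrauerDiagram G n} {c d : ℕ × G} (hc : x.HasCup c) (hd : x.HasCup d)
    (hcd : c ≠ d) : c.1 ≠ d.1 ∧ c.1 + 1 ≠ d.1 ∧ c.1 ≠ d.1 + 1 := by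
  have hc' := hc
  have hd' := hd
  obtain ⟨i, j, h1, h2, h3, h4⟩ := hc
  obtain ⟨i', j', h1', h2', h3', h4'⟩ := hd
  refine ⟨fun h => hcd ?_, fun h => ?_, fun h => ?_⟩
  · obtain ⟨-, -, -, h5⟩ := hd'.mate_fst (i := i) (by omega)
    exact Prod.ext h (h4.symm.trans h5)
  · obtain ⟨l, h5, h6, -⟩ := hc'.mate_snd (j := i') (by omega)
    rw [h3'] at h6
    have := Sum.inl.inj h6
    omega
  · obtain ⟨l, h5, h6, -⟩ := hc'.mate_fst (i := j') (by omega)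
    have h7 := congrArg x.mate h3'
    rw [x.mate_mate, h6] at h7
    have := Sum.inl.inj h7
    omega

/-- A planar diagram with an edge between left-hand nodes has a cup. -/
theorem IsPlanar.exists_hasCup_of_mate {x : BrauerDiagram G n} (hx : x.IsPlanar) :
    ∀ (d : ℕ) (i j : Fin n), (j : ℕ) = i + d → 0 < d → x.mate (Sum.inl i) = Sum.inl j →
      ∃ c, x.HasCup c := by
  intro d
  induction d using Nat.strong_induction_on with
  | _ d ih =>
    intro i j hij hd hm
    by_cases h1 : d = 1
    · exact ⟨(i, x.label (Sum.inl i)), i, j, rfl, by omega, hm, rfl⟩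
    -- By planarity the node after `i` is matched strictly inside the edge from `i` to `j`: `h2`
    -- excludes a mate beyond `j` or in the right column, and `h3` a mate before `i`. This gives a
    -- shorter edge between left-hand nodes; an edge of length `1` is a cup.
    let l : Fin n := ⟨i + 1, by omega⟩
    have h2 := hx (Sum.inl i) (Sum.inl l)
    have h3 := hx (x.mate (Sum.inl l)) (Sum.inl i)
    have h4 := x.mate_ne (Sum.inl l)
    rw [x.mate_mate] at h3
    have hl : (l : ℕ) = i + 1 := rfl
    have hne : ∀ m, x.mate (Sum.inl l) = Sum.inl m → m ≠ i ∧ m ≠ j := by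
      intro m hml
      have h5 := congrArg x.mate hml
      rw [x.mate_mate] at h5
      constructor
      · rintro rfl
        rw [hm] at h5
        have := Sum.inl.inj h5
        omega
      · rintro rfl
        rw [← hm, x.mate_mate] at h5
        have := Sum.inl.inj h5
        omega
    rw [hm] at h2 h3
    rcases hml : x.mate (Sum.inl l) with m | m
    · have hne' := hne m hml
      simp only [hml, pos, Sum.elim_inl, hl] at h2 h3
      have h5 : (m : ℕ) ≠ l := fun h => h4 (by rw [hml, Fin.ext h])
      have h6 : (m : ℕ) ≠ i := fun h => hne'.1 (Fin.ext h)
      have h7 : (m : ℕ) ≠ j := fun h => hne'.2 (Fin.ext h)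
      exact ih (m - l) (by omega) l m (by omega) (by omega) hml
    · simp only [hml, pos, Sum.elim_inl, Sum.elim_inr, hl] at h2
      omega

theorem IsPlanar.exists_hasCup {x : BrauerDiagram G n} (hx : x.IsPlanar) (h : ¬ x.IsThrough) :
    ∃ c, x.HasCup c := by
  by_contra hc
  refine h (isThrough_of_left x fun i => ?_)
  rcases hi : x.mate (Sum.inl i) with j | j
  · exfalso
    have hij : (i : ℕ) ≠ j := fun h => x.mate_ne (Sum.inl i) (by rw [hi, Fin.ext h])
    rcases lt_or_gt_of_ne hij with h1 | h1
    · exact hc (hx.exists_hasCup_of_mate (j - i) i j (by omega) (by omega) hi)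
    · exact hc (hx.exists_hasCup_of_mate (i - j) j i (by omega) (by omega)
        (by rw [← hi, x.mate_mate]))
  · rfl

/-- This is where the parity of `n` enters: a perfect matching of the left column within itself
would be a fixed-point-free involution on a set of odd size. -/
theorem exists_through_node (hn : Odd n) (x : BrauerDiagram G n) :
    ∃ i j : Fin n, x.mate (Sum.inl i) = Sum.inr j := by
  by_contra! hc
  have h1 : ∀ i, ∃ j, x.mate (Sum.inl i) = Sum.inl j := by
    intro i
    rcases hi : x.mate (Sum.inl i) with j | j
    · exact ⟨j, rfl⟩
    · exact absurd hi (hc i j)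
  choose f hf using h1
  -- Modulo `2` the two ends of each edge cancel in the sum, which therefore vanishes, although it
  -- equals `n`.
  have h2 : ∑ i : Fin n, (1 : ZMod 2) = 0 := by
    refine Finset.sum_involution (fun i _ => f i) (fun i _ => by decide) (fun i _ _ h => ?_)
      (fun _ _ => Finset.mem_univ _) (fun i _ => ?_)
    · exact x.mate_ne (Sum.inl i) (by rw [hf, h])
    · have := x.mate_mate (Sum.inl i)
      rw [hf, hf] at this
      exact Sum.inl.inj this
  rw [Finset.sum_const, Finset.card_univ, Fintype.card_fin, nsmul_eq_mul, mul_one,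
    ZMod.natCast_eq_zero_iff_even] at h2
  exact (Nat.not_even_iff_odd.2 hn) h2

/-- If `e` is a left unit for the diagrams with the cups in `S`, then a shift times `e` is a left
unit for the diagrams with one more cup. -/
theorem exists_unit_insert {S : Finset (ℕ × G)} {c : ℕ × G} {a b d : Fin n} {hab : a ≠ b}
    {hbd : b ≠ d} {had : a ≠ d} (hp : (shift a b d hab hbd had c.2).IsPlanar)
    (ha : ∀ y : BrauerDiagram G n, y.HasCup c →
      y.mate (Sum.inl a) = Sum.inl b ∧ y.label (Sum.inl a) = c.2)
    (hc : (shift a b d hab hbd had c.2).HasCup c)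
    (hS : ∀ s ∈ S, ∀ i : Fin n, ((i : ℕ) = s.1 ∨ (i : ℕ) = s.1 + 1) → i ≠ a ∧ i ≠ b ∧ i ≠ d)
    (he : ∃ e : BrauerDiagram G n, e.IsPlanar ∧ (∀ s ∈ S, e.HasCup s) ∧
      ∀ y : BrauerDiagram G n, (∀ s ∈ S, y.HasCup s) → comp e y = y ∧ loops e y = 0) :
    ∃ e : BrauerDiagram G n, e.IsPlanar ∧ (e.HasCup c ∧ ∀ s ∈ S, e.HasCup s) ∧
      ∀ y : BrauerDiagram G n, y.HasCup c → (∀ s ∈ S, y.HasCup s) →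
        comp e y = y ∧ loops e y = 0 := by
  obtain ⟨e, he1, he2, he3⟩ := he
  refine ⟨_, hp.comp he1, ⟨hc.comp e, fun s hs => ?_⟩, fun y hy hyS => ?_⟩
  · obtain ⟨i, j, h1, h2, h3, h4⟩ := he2 s hs
    obtain ⟨n1, n2, n3⟩ := hS s hs i (.inl h1)
    obtain ⟨n4, n5, n6⟩ := hS s hs j (.inr h2)
    exact ⟨i, j, h1, h2, shift_comp_mate_left h3 h4 n1 n2 n3 n4 n5 n6⟩
  · obtain ⟨e1, e2⟩ := he3 y hyS
    obtain ⟨h1, h2⟩ := ha y hy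
    -- Neither multiplying `y` by `e` nor then multiplying by the shift closes a loop. By the
    -- cocycle identity and the cancellation-free sum of multisets, multiplying `y` by the product
    -- closes none either.
    have hl := loops_cocycle (shift a b d hab hbd had c.2) e y
    rw [e1, e2, loops_shift h1 h2] at hl
    refine ⟨?_, ?_⟩
    · rw [comp_assoc, e1, shift_comp h1 h2]
    · exact (add_eq_zero.1 (hl.trans (add_zero _))).2

/-- The diagrams that have the cups in `S` have a common left unit with the cups in `S`. -/
theorem exists_unit_of_through {f f' : Fin n} {x : BrauerDiagram G n}
    (hf : x.mate (Sum.inl f) = Sum.inr f') : ∀ (m : ℕ) (S : Finset (ℕ × G)), S.card = m →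
    (∀ s ∈ S, x.HasCup s) → ∃ e : BrauerDiagram G n, e.IsPlanar ∧ (∀ s ∈ S, e.HasCup s) ∧
      ∀ y : BrauerDiagram G n, (∀ s ∈ S, y.HasCup s) → comp e y = y ∧ loops e y = 0 := by
  classical
  intro m
  induction m with
  | zero =>
    intro S hS hx
    obtain rfl := Finset.card_eq_zero.1 hS
    exact ⟨one G n, isPlanar_one, by simp, fun y _ => ⟨one_comp y, loops_one_left y⟩⟩
  | succ m ih =>
    intro S hS hx
    -- The cup nearest to the through node `f` is treated first: its neighbour on the side of `f`
    -- lies on no other cup of `S`, since such a cup would be nearer to `f`, meet `c`, or contain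
    -- `f`.
    obtain ⟨c, hcS, hmin⟩ := Finset.exists_min_image S (fun c => ((c.1 : ℤ) - f).natAbs)
      (Finset.card_pos.1 (by omega))
    have hd : ∀ s ∈ S.erase c, s ∈ S ∧ s.1 ≠ c.1 ∧ s.1 + 1 ≠ c.1 ∧ s.1 ≠ c.1 + 1 ∧
        ((c.1 : ℤ) - f).natAbs ≤ ((s.1 : ℤ) - f).natAbs := by
      intro s hs
      obtain ⟨h1, h2⟩ := Finset.mem_erase.1 hs
      have := (hx s h2).disjoint (hx c hcS) h1
      exact ⟨h2, this.1, this.2.1, this.2.2, hmin s h2⟩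
    have hfree : ∀ s ∈ S, s.1 ≠ f ∧ s.1 + 1 ≠ f := by
      intro s hs
      constructor
      · intro h
        obtain ⟨_, _, h1, _⟩ := (hx s hs).mate_fst (i := f) h.symm
        simp [hf] at h1
      · intro h
        obtain ⟨_, _, h1, _⟩ := (hx s hs).mate_snd (j := f) h.symm
        simp [hf] at h1
    have he := ih (S.erase c) (by rw [Finset.card_erase_of_mem hcS, hS]; rfl)
      (fun s hs => hx s (hd s hs).1)
    have hfc := hfree c hcS
    suffices h : ∃ e : BrauerDiagram G n, e.IsPlanar ∧ (e.HasCup c ∧ ∀ s ∈ S.erase c, e.HasCup s) ∧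
        ∀ y : BrauerDiagram G n, y.HasCup c → (∀ s ∈ S.erase c, y.HasCup s) →
          comp e y = y ∧ loops e y = 0 by
      obtain ⟨e, h1, ⟨h2, h3⟩, h4⟩ := h
      refine ⟨e, h1, fun s hs => ?_, fun y hy => h4 y (hy c hcS) fun s hs => hy s (hd s hs).1⟩
      by_cases hsc : s = c
      · exact hsc ▸ h2
      · exact h3 s (Finset.mem_erase.2 ⟨hsc, hs⟩)
    obtain ⟨i, j, h1, h2, h3, h4⟩ := hx c hcS
    rcases lt_or_gt_of_ne hfc.1 with hlt | hgt
    · let d : Fin n := ⟨c.1 + 2, by have := f.2; omega⟩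
      have hdv : (d : ℕ) = c.1 + 2 := rfl
      refine exists_unit_insert (a := i) (b := j) (d := d)
        (hab := fun h => by have := congrArg Fin.val h; omega)
        (hbd := fun h => by have := congrArg Fin.val h; omega)
        (had := fun h => by have := congrArg Fin.val h; omega)
        (isPlanar_shift_up (by omega) (by omega)) (fun y hy => ?_)
        ⟨i, j, h1, h2, shift_mate_inl_fst, shift_label_inl_fst⟩ (fun s hs l hl => ?_) he
      · obtain ⟨j', k1, k2, k3⟩ := hy.mate_fst h1
        obtain rfl : j' = j := Fin.ext (by omega)
        exact ⟨k2, k3⟩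
      · have := hd s hs
        have := hfree s this.1
        refine ⟨fun h => ?_, fun h => ?_, fun h => ?_⟩ <;> have := congrArg Fin.val h <;> omega
    · let d : Fin n := ⟨c.1 - 1, by omega⟩
      have hdv : (d : ℕ) = c.1 - 1 := rfl
      refine exists_unit_insert (a := j) (b := i) (d := d)
        (hab := fun h => by have := congrArg Fin.val h; omega)
        (hbd := fun h => by have := congrArg Fin.val h; omega)
        (had := fun h => by have := congrArg Fin.val h; omega)
        (isPlanar_shift_down (by omega) (by omega)) (fun y hy => ?_)
        ⟨i, j, h1, h2, shift_mate_inl_snd, shift_label_inl_snd⟩ (fun s hs l hl => ?_) he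
      · obtain ⟨i', k1, k2, k3⟩ := hy.mate_snd h2
        obtain rfl : i' = i := Fin.ext (by omega)
        exact ⟨k2, k3⟩
      · have := hd s hs
        have := hfree s this.1
        refine ⟨fun h => ?_, fun h => ?_, fun h => ?_⟩ <;> have := congrArg Fin.val h <;> omega

theorem exists_unit (hn : Odd n) (S : Finset (ℕ × G)) (x : BrauerDiagram G n)
    (hx : ∀ s ∈ S, x.HasCup s) : ∃ e : BrauerDiagram G n, e.IsPlanar ∧ (∀ s ∈ S, e.HasCup s) ∧
      ∀ y : BrauerDiagram G n, (∀ s ∈ S, y.HasCup s) → comp e y = y ∧ loops e y = 0 := by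
  obtain ⟨f, f', hf⟩ := exists_through_node hn x
  exact exists_unit_of_through hf S.card S rfl hx

end BrauerDiagram

end GTemperleyLieb

/-! ### Right ideals spanned by diagrams, and elements supported on them -/

namespace GTemperleyLieb

open LabelledGraph BrauerDiagram

namespace GTL

variable {G : Type*} [CommGroup G] {n : ℕ} {k : Type*} [CommRing k] [MulSemiringAction G k]
  {δ : k}

/-- The linear combinations of the diagrams in `X`. -/
noncomputable def spanOf (δ : k) (X : Set (TLDiagram G n)) : Submodule k (GTL G n δ) :=
  Submodule.span k (basis G n δ '' X)

theorem basis_mem_spanOf {X : Set (TLDiagram G n)} {x : TLDiagram G n} (hx : x ∈ X) :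
    basis G n δ x ∈ spanOf δ X :=
  Submodule.subset_span ⟨x, hx, rfl⟩

theorem spanOf_mono {X Y : Set (TLDiagram G n)} (h : X ⊆ Y) : spanOf δ X ≤ spanOf δ Y :=
  Submodule.span_mono (Set.image_mono h)

theorem mem_spanOf {X : Set (TLDiagram G n)} {a : GTL G n δ} :
    a ∈ spanOf δ X ↔ ↑((basis G n δ).repr a).support ⊆ X :=
  (basis G n δ).mem_span_image

/-- Membership in these spans is a condition on supports with respect to a basis. Hence the right
ideals intersect as the sets of diagrams do, which the Mayer-Vietoris argument needs. -/
theorem spanOf_inter (X Y : Set (TLDiagram G n)) :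
    spanOf δ (X ∩ Y) = spanOf δ X ⊓ spanOf δ Y := by
  ext a
  rw [Submodule.mem_inf, mem_spanOf, mem_spanOf, mem_spanOf, Set.subset_inter_iff]

theorem spanOf_union (X Y : Set (TLDiagram G n)) :
    spanOf δ (X ∪ Y) = spanOf δ X ⊔ spanOf δ Y := by
  rw [spanOf, Set.image_union, Submodule.span_union]
  rfl

/-- `X` is closed under composition with diagrams on the right. -/
def RightClosed (X : Set (TLDiagram G n)) : Prop := ∀ x ∈ X, ∀ y, TLDiagram.comp x y ∈ X

theorem RightClosed.inter {X Y : Set (TLDiagram G n)} (hX : RightClosed X) (hY : RightClosed Y) :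
    RightClosed (X ∩ Y) := fun x hx y => ⟨hX x hx.1 y, hY x hx.2 y⟩

theorem RightClosed.mul_mem {X : Set (TLDiagram G n)} (hX : RightClosed X) {a : GTL G n δ}
    (ha : a ∈ spanOf δ X) (b : GTL G n δ) : a * b ∈ spanOf δ X := by
  induction ha using Submodule.span_induction with
  | mem _ h =>
    obtain ⟨x, hx, rfl⟩ := h
    induction b using induction with
    | h0 => rw [mul_zero]; exact zero_mem _
    | hadd b c hb hc => rw [mul_add]; exact add_mem hb hc
    | hsmul r b hb => rw [GTL.mul_smul]; exact Submodule.smul_mem _ _ hb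
    | hbasis y =>
      rw [basis_mul_basis]
      exact Submodule.smul_mem _ _ (basis_mem_spanOf (hX x hx y))
  | zero => rw [zero_mul]; exact zero_mem _
  | add _ _ _ _ h1 h2 => rw [add_mul]; exact add_mem h1 h2
  | smul r _ _ h => rw [GTL.smul_mul]; exact Submodule.smul_mem _ _ h

/-- `x` has coefficients in the span of `X`. -/
def Supp (X : Set (TLDiagram G n)) {Q : Type*} [AddCommGroup Q] [Module (GTL G n δ) Q] (x : Q) :
    Prop := ∀ f : Q →ₗ[GTL G n δ] GTL G n δ, f x ∈ spanOf δ X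

section Supp

variable {X Y : Set (TLDiagram G n)} {Q R : Type*} [AddCommGroup Q] [Module (GTL G n δ) Q]
  [AddCommGroup R] [Module (GTL G n δ) R]

theorem Supp.add {x y : Q} (hx : Supp (δ := δ) X x) (hy : Supp (δ := δ) X y) :
    Supp (δ := δ) X (x + y) := fun f => by
  rw [map_add]; exact add_mem (hx f) (hy f)

theorem Supp.sub {x y : Q} (hx : Supp (δ := δ) X x) (hy : Supp (δ := δ) X y) :
    Supp (δ := δ) X (x - y) := fun f => by
  rw [map_sub]; exact sub_mem (hx f) (hy f)

theorem Supp.neg {x : Q} (hx : Supp (δ := δ) X x) : Supp (δ := δ) X (-x) := fun f => by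
  rw [map_neg]; exact neg_mem (hx f)

theorem Supp.zero : Supp (δ := δ) X (0 : Q) := fun f => by
  rw [map_zero]; exact zero_mem _

theorem Supp.sum {ι : Type*} {s : Finset ι} {g : ι → Q} (h : ∀ i ∈ s, Supp (δ := δ) X (g i)) :
    Supp (δ := δ) X (∑ i ∈ s, g i) := fun f => by
  rw [map_sum]; exact sum_mem fun i hi => h i hi f

theorem Supp.map {x : Q} (hx : Supp (δ := δ) X x) (d : Q →ₗ[GTL G n δ] R) :
    Supp (δ := δ) X (d x) := fun f => hx (f ∘ₗ d)

theorem Supp.mono (h : X ⊆ Y) {x : Q} (hx : Supp (δ := δ) X x) : Supp (δ := δ) Y x :=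
  fun f => spanOf_mono h (hx f)

theorem Supp.inter {x : Q} (hx : Supp (δ := δ) X x) (hy : Supp (δ := δ) Y x) :
    Supp (δ := δ) (X ∩ Y) x := fun f => by
  rw [spanOf_inter]; exact ⟨hx f, hy f⟩

/-- Together with `exists_coeff` this shows that, for `J` the right ideal spanned by `X` and `Q`
projective, the elements with `Supp X` are exactly those of `J Q`. Expressed through functionals,
compatibility with intersections and with `A`-linear maps is immediate. -/
theorem RightClosed.supp_smul (hX : RightClosed X) {a : GTL G n δ} (ha : a ∈ spanOf δ X) (x : Q) :
    Supp (δ := δ) X (a • x) := fun f => by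
  rw [map_smul, smul_eq_mul]; exact hX.mul_mem ha _

/-- A section of the canonical surjection from the free module on `Q` is a dual basis: its
coordinates are functionals on `Q`, and they recover `x` as a finite combination. -/
theorem exists_coeff (A Q : Type*) [Ring A] [AddCommGroup Q] [Module A Q] [Module.Projective A Q] :
    ∃ s : Q →ₗ[A] Q →₀ A, ∀ x : Q, ∑ q ∈ (s x).support, s x q • q = x := by
  obtain ⟨s, hs⟩ := Module.projective_def'.1 ‹Module.Projective A Q›
  exact ⟨s, fun x => LinearMap.congr_fun hs x⟩

variable [Module.Projective (GTL G n δ) Q]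

theorem Supp.eq_of_empty {x : Q} (hx : Supp (δ := δ) (∅ : Set (TLDiagram G n)) x) : x = 0 := by
  obtain ⟨s, hs⟩ := exists_coeff (GTL G n δ) Q
  rw [← hs x]
  refine Finset.sum_eq_zero fun q _ => ?_
  have h : s x q ∈ spanOf δ ∅ := hx (Finsupp.lapply q ∘ₗ s)
  rw [spanOf, Set.image_empty, Submodule.span_empty, Submodule.mem_bot] at h
  rw [h, zero_smul]

/-- Each dual-basis coefficient of `x` is split into a part in the span of `X` and a part in the
span of `Y`. -/
theorem Supp.exists_add (hX : RightClosed X) (hY : RightClosed Y) {x : Q}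
    (hx : Supp (δ := δ) (X ∪ Y) x) :
    ∃ y z : Q, Supp (δ := δ) X y ∧ Supp (δ := δ) Y z ∧ y + z = x := by
  obtain ⟨s, hs⟩ := exists_coeff (GTL G n δ) Q
  have h : ∀ q, ∃ b ∈ spanOf δ X, ∃ c ∈ spanOf δ Y, b + c = s x q := fun q => by
    have : s x q ∈ spanOf δ (X ∪ Y) := hx (Finsupp.lapply q ∘ₗ s)
    rwa [spanOf_union, Submodule.mem_sup] at this
  choose b hb c hc hbc using h
  refine ⟨∑ q ∈ (s x).support, b q • q, ∑ q ∈ (s x).support, c q • q,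
    .sum fun q _ => hX.supp_smul (hb q) q, .sum fun q _ => hY.supp_smul (hc q) q, ?_⟩
  rw [← Finset.sum_add_distrib]
  conv_rhs => rw [← hs x]
  exact Finset.sum_congr rfl fun q _ => by rw [← add_smul, hbc]

/-- The unit fixes every dual-basis coefficient of `x`, hence `x` itself. -/
theorem Supp.smul_eq_of_unit {e : GTL G n δ} (he : ∀ a ∈ spanOf δ X, e * a = a) {x : Q}
    (hx : Supp (δ := δ) X x) : e • x = x := by
  obtain ⟨s, hs⟩ := exists_coeff (GTL G n δ) Q
  conv_rhs => rw [← hs x]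
  conv_lhs => rw [← hs x]
  rw [Finset.smul_sum]
  refine Finset.sum_congr rfl fun q _ => ?_
  have h : e * s x q = s x q := he _ (hx (Finsupp.lapply q ∘ₗ s))
  rw [← mul_smul, h]

end Supp

/-- The diagrams with all the cups in `S`. -/
def withCups (S : Finset (ℕ × G)) : Set (TLDiagram G n) := {x | ∀ s ∈ S, x.1.HasCup s}

/-- The diagrams with at least one of the cups in `F`. -/
def withSomeCup (F : Finset (ℕ × G)) : Set (TLDiagram G n) := {x | ∃ s ∈ F, x.1.HasCup s}

/-- The diagrams with a left-to-left or right-to-right connection. -/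
def nonThrough (G : Type*) [CommGroup G] (n : ℕ) : Set (TLDiagram G n) := {x | ¬ x.1.IsThrough}

theorem rightClosed_withCups (S : Finset (ℕ × G)) : RightClosed (withCups (n := n) S) :=
  fun _ hx y s hs => (hx s hs).comp y.1

theorem rightClosed_withSomeCup (F : Finset (ℕ × G)) : RightClosed (withSomeCup (n := n) F) := by
  rintro x ⟨s, hs, hx⟩ y
  exact ⟨s, hs, hx.comp y.1⟩

theorem rightClosed_nonThrough : RightClosed (nonThrough G n) :=
  fun _ hx _ h => hx h.left

/-- Right-to-right connections survive composition on the left, so this span is a two-sided ideal.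
The spans of `withCups` and `withSomeCup` are in general only right ideals. -/
theorem mul_mem_nonThrough (a : GTL G n δ) {b : GTL G n δ} (hb : b ∈ spanOf δ (nonThrough G n)) :
    a * b ∈ spanOf δ (nonThrough G n) := by
  induction hb using Submodule.span_induction with
  | mem _ h =>
    obtain ⟨x, hx, rfl⟩ := h
    induction a using induction with
    | h0 => rw [zero_mul]; exact zero_mem _
    | hadd b c hb hc => rw [add_mul]; exact add_mem hb hc
    | hsmul r b hb => rw [GTL.smul_mul]; exact Submodule.smul_mem _ _ hb
    | hbasis y =>
      rw [basis_mul_basis]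
      exact Submodule.smul_mem _ _ (basis_mem_spanOf fun h => hx h.right)
  | zero => rw [mul_zero]; exact zero_mem _
  | add _ _ _ _ h1 h2 => rw [mul_add]; exact add_mem h1 h2
  | smul r _ _ h => rw [GTL.mul_smul]; exact Submodule.smul_mem _ _ h

/-- The common left unit of the diagrams is a left unit of their span, because no loops form and all
pre-factors are empty products. -/
theorem exists_unit_withCups (δ : k) (hn : Odd n) {S : Finset (ℕ × G)}
    (hS : (withCups (n := n) S).Nonempty) :
    ∃ e ∈ withCups (n := n) S, ∀ a ∈ spanOf δ (withCups S), basis G n δ e * a = a := by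
  obtain ⟨x, hx⟩ := hS
  obtain ⟨e, he, heS, hey⟩ := exists_unit hn S x.1 hx
  obtain ⟨e, rfl⟩ : ∃ e' : TLDiagram G n, e'.1 = e := ⟨⟨e, he⟩, rfl⟩
  refine ⟨e, heS, fun a ha => ?_⟩
  induction ha using Submodule.span_induction with
  | mem _ h =>
    obtain ⟨y, hy, rfl⟩ := h
    obtain ⟨h1, h2⟩ := hey y.1 hy
    have h3 : TLDiagram.comp e y = y := Subtype.ext h1
    rw [basis_mul_basis, h3, TLDiagram.weight, h2, Multiset.map_zero, Multiset.prod_zero, one_smul]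
  | zero => rw [mul_zero]
  | add _ _ _ _ h1 h2 => rw [mul_add, h1, h2]
  | smul r _ _ h => rw [GTL.mul_smul, h]

/-- If `G` is infinite there may be infinitely many labelled cups, while the induction on sets of
cups only reaches finite ones. An element of the algebra has finite support, so finitely many cups
suffice. -/
theorem exists_mem_withSomeCup {a : GTL G n δ} (ha : a ∈ spanOf δ (nonThrough G n)) :
    ∃ F : Finset (ℕ × G), a ∈ spanOf δ (withSomeCup F) := by
  classical
  induction ha using Submodule.span_induction with
  | mem _ h =>
    obtain ⟨x, hx, rfl⟩ := h
    obtain ⟨c, hc⟩ := x.2.exists_hasCup hx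
    exact ⟨{c}, basis_mem_spanOf ⟨c, by simp, hc⟩⟩
  | zero => exact ⟨∅, zero_mem _⟩
  | add _ _ _ _ h1 h2 =>
    obtain ⟨F, hF⟩ := h1
    obtain ⟨F', hF'⟩ := h2
    refine ⟨F ∪ F', add_mem (spanOf_mono ?_ hF) (spanOf_mono ?_ hF')⟩ <;>
      rintro x ⟨s, hs, hx⟩ <;> exact ⟨s, by simp [hs], hx⟩
  | smul r _ _ h =>
    obtain ⟨F, hF⟩ := h
    exact ⟨F, Submodule.smul_mem _ _ hF⟩

theorem Supp.exists_withSomeCup {Q : Type*} [AddCommGroup Q] [Module (GTL G n δ) Q]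
    [Module.Projective (GTL G n δ) Q] {x : Q} (hx : Supp (δ := δ) (nonThrough G n) x) :
    ∃ F : Finset (ℕ × G), Supp (δ := δ) (withSomeCup (n := n) F) x := by
  classical
  obtain ⟨s, hs⟩ := exists_coeff (GTL G n δ) Q
  have h : ∀ q, ∃ F : Finset (ℕ × G), s x q ∈ spanOf δ (withSomeCup F) := fun q =>
    exists_mem_withSomeCup (hx (Finsupp.lapply q ∘ₗ s))
  choose F hF using h
  refine ⟨(s x).support.biUnion F, ?_⟩
  rw [← hs x]
  refine .sum fun q hq => (rightClosed_withSomeCup _).supp_smul (spanOf_mono ?_ (hF q)) q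
  rintro y ⟨c, hc, hy⟩
  exact ⟨c, Finset.mem_biUnion.2 ⟨q, by rwa [hs], hc⟩, hy⟩

/-! ### Acyclicity by Mayer-Vietoris over the cups -/

section Acyclic

variable {Q : ℕ → Type*} [∀ i, AddCommGroup (Q i)] [∀ i, Module (GTL G n δ) (Q i)]

/-- The elements of the complex `Q` with coefficients in the span of `X` form an acyclic complex. -/
structure Acyclic (d : ∀ i, Q (i + 1) →ₗ[GTL G n δ] Q i) (X : Set (TLDiagram G n)) : Prop where
  zero : ∀ x : Q 0, Supp (δ := δ) X x → ∃ z : Q 1, Supp (δ := δ) X z ∧ d 0 z = x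
  succ : ∀ i, ∀ x : Q (i + 1), Supp (δ := δ) X x → d i x = 0 →
    ∃ z : Q (i + 2), Supp (δ := δ) X z ∧ d (i + 1) z = x

variable [∀ i, Module.Projective (GTL G n δ) (Q i)] {d : ∀ i, Q (i + 1) →ₗ[GTL G n δ] Q i}
  {X Y : Set (TLDiagram G n)}

/-- This is the Mayer-Vietoris argument by hand: a cycle is split as `a + b`, the common boundary `d
a = - d b` lies in the intersection, and a chain `c` of the intersection with the same boundary
turns both parts into the cycles `a - c` and `b + c`. -/
theorem Acyclic.union (hX : RightClosed X) (hY : RightClosed Y)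
    (hd : ∀ i x, d i (d (i + 1) x) = 0) (h1 : Acyclic d X) (h2 : Acyclic d Y)
    (h3 : Acyclic d (X ∩ Y)) : Acyclic d (X ∪ Y) := by
  have hl {i : ℕ} {z : Q i} : Supp (δ := δ) X z → Supp (δ := δ) (X ∪ Y) z :=
    .mono Set.subset_union_left
  have hr {i : ℕ} {z : Q i} : Supp (δ := δ) Y z → Supp (δ := δ) (X ∪ Y) z :=
    .mono Set.subset_union_right
  constructor
  · intro x hx
    obtain ⟨a, b, ha, hb, rfl⟩ := hx.exists_add hX hY
    obtain ⟨z, hz, rfl⟩ := h1.zero a ha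
    obtain ⟨w, hw, rfl⟩ := h2.zero b hb
    exact ⟨z + w, (hl hz).add (hr hw), map_add _ _ _⟩
  · intro i x hx hdx
    obtain ⟨a, b, ha, hb, rfl⟩ := hx.exists_add hX hY
    have hab : d i a = -d i b := by
      rw [map_add] at hdx
      exact eq_neg_of_add_eq_zero_left hdx
    have hda : Supp (δ := δ) (X ∩ Y) (d i a) := by
      refine (ha.map (d i)).inter ?_
      rw [hab]
      exact (hb.map (d i)).neg
    obtain ⟨c, hc, hdc⟩ : ∃ c : Q (i + 1), Supp (δ := δ) (X ∩ Y) c ∧ d i c = d i a := by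
      -- In degree `0` the acyclicity of the intersection imposes no cycle condition on `d a`; in
      -- higher degrees that condition is `d d = 0`.
      cases i with
      | zero => exact h3.zero _ hda
      | succ i => exact h3.succ i _ hda (hd i a)
    obtain ⟨z, hz, hz'⟩ := h1.succ i (a - c) (ha.sub (hc.mono Set.inter_subset_left))
      (by rw [map_sub, hdc, sub_self])
    obtain ⟨w, hw, hw'⟩ := h2.succ i (b + c) (hb.add (hc.mono Set.inter_subset_right))
      (by rw [map_add, hdc, hab, add_neg_cancel])
    exact ⟨z + w, (hl hz).add (hr hw), by rw [map_add, hz', hw']; abel⟩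

theorem Acyclic.empty : Acyclic d ∅ where
  zero x hx := ⟨0, .zero, by rw [hx.eq_of_empty, map_zero]⟩
  succ i x hx _ := ⟨0, .zero, by rw [hx.eq_of_empty, map_zero]⟩

variable {M : Type*} [AddCommGroup M] [Module (GTL G n δ) M] {ε : Q 0 →ₗ[GTL G n δ] M}

/-- Multiplication by `e` commutes with the differentials, fixes the elements supported on `X` and
maps everything into them. A preimage in the full resolution is therefore corrected by multiplying
it by `e`. In degree `0`, `e` kills the resolved module, so every element fixed by `e` is in the
kernel of the augmentation. -/
theorem Acyclic.of_unit (hX : RightClosed X) (h0 : ∀ x, ε x = 0 → ∃ z, d 0 z = x)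
    (hs : ∀ i x, d i x = 0 → ∃ z, d (i + 1) z = x) {e : GTL G n δ} (heX : e ∈ spanOf δ X)
    (he : ∀ a ∈ spanOf δ X, e * a = a) (heM : ∀ m : M, e • m = 0) : Acyclic d X where
  zero x hx := by
    have hex := hx.smul_eq_of_unit he
    obtain ⟨z, hz⟩ := h0 x (by rw [← hex, map_smul, heM])
    exact ⟨e • z, hX.supp_smul heX z, by rw [map_smul, hz, hex]⟩
  succ i x hx hdx := by
    obtain ⟨z, hz⟩ := hs i x hdx
    exact ⟨e • z, hX.supp_smul heX z, by rw [map_smul, hz, hx.smul_eq_of_unit he]⟩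

variable (hn : Odd n) (hd : ∀ i x, d i (d (i + 1) x) = 0) (h0 : ∀ x, ε x = 0 → ∃ z, d 0 z = x)
  (hs : ∀ i x, d i x = 0 → ∃ z, d (i + 1) z = x)
  (hM : ∀ x ∈ nonThrough G n, ∀ m : M, basis G n δ x • m = 0)

include hn h0 hs hM in
theorem acyclic_withCups {S : Finset (ℕ × G)} (hS : S.Nonempty) : Acyclic d (withCups S) := by
  -- The cups in `S` may overlap or not fit into the column, in which case no diagram has all of
  -- them.
  rcases (withCups (n := n) S).eq_empty_or_nonempty with h | h
  · rw [h]
    exact .empty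
  · obtain ⟨e, heS, he⟩ := exists_unit_withCups δ hn h
    obtain ⟨s, hs'⟩ := hS
    exact .of_unit (rightClosed_withCups S) h0 hs (basis_mem_spanOf heS) he
      (hM e (heS s hs').not_isThrough)

include hn hd h0 hs hM in
-- Adding a cup `c` to `F` adjoins the diagrams with all the cups in `insert c S`, and the overlap
-- with the previous set has the same form with `insert c S` in place of `S`. Hence the induction on
-- `F` is uniform in `S`. The adjoined sets always prescribe at least one cup, so they are acyclic
-- even when `S` is empty.
theorem acyclic_inter (F : Finset (ℕ × G)) : ∀ S : Finset (ℕ × G),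
    Acyclic d (withCups S ∩ withSomeCup F) := by
  classical
  induction F using Finset.induction_on with
  | empty =>
    intro S
    have : withCups (n := n) S ∩ withSomeCup ∅ = ∅ := by
      ext x
      simp [withSomeCup]
    rw [this]
    exact .empty
  | insert c F _ ih =>
    intro S
    have h1 : withCups (n := n) S ∩ withSomeCup (insert c F) =
        (withCups S ∩ withSomeCup F) ∪ withCups (insert c S) := by
      ext x
      simp only [withCups, withSomeCup, Set.mem_inter_iff, Set.mem_union, Set.mem_ofPred_eq,
        Finset.mem_insert, exists_eq_or_imp, forall_eq_or_imp]
      rw [and_or_left, or_comm, and_comm (b := x.1.HasCup c)]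
    have h2 : (withCups (n := n) S ∩ withSomeCup F) ∩ withCups (insert c S) =
        withCups (insert c S) ∩ withSomeCup F := by
      ext x
      simp only [withCups, withSomeCup, Set.mem_inter_iff, Set.mem_ofPred_eq,
        Finset.mem_insert, forall_eq_or_imp]
      tauto
    rw [h1]
    refine Acyclic.union ((rightClosed_withCups S).inter (rightClosed_withSomeCup F))
      (rightClosed_withCups _) hd (ih S)
      (acyclic_withCups hn h0 hs hM (Finset.insert_nonempty c S)) ?_
    rw [h2]
    exact ih _

include hn hd h0 hs hM in
/-- If `Q` is a projective resolution of a module on which the diagrams with a left-to-left or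
right-to-right connection act as `0`, then the elements of `Q` with coefficients in the span of
these diagrams form an acyclic complex. -/
theorem acyclic_nonThrough : Acyclic d (nonThrough G n) := by
  have hF : ∀ F : Finset (ℕ × G), Acyclic d (withSomeCup F) := fun F => by
    have : withCups (n := n) ∅ ∩ withSomeCup F = withSomeCup F := by
      ext x
      simp [withCups]
    rw [← this]
    exact acyclic_inter hn hd h0 hs hM F ∅
  have hle : ∀ F : Finset (ℕ × G), withSomeCup F ⊆ nonThrough G n := by
    rintro F x ⟨s, -, hx⟩
    exact hx.not_isThrough
  constructor
  · intro x hx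
    obtain ⟨F, hxF⟩ := hx.exists_withSomeCup
    obtain ⟨z, hz, hz'⟩ := (hF F).zero x hxF
    exact ⟨z, hz.mono (hle F), hz'⟩
  · intro i x hx hdx
    obtain ⟨F, hxF⟩ := hx.exists_withSomeCup
    obtain ⟨z, hz, hz'⟩ := (hF F).succ i x hxF hdx
    exact ⟨z, hz.mono (hle F), hz'⟩

end Acyclic

end GTL

end GTemperleyLieb

/-! ### The quotient algebra: the group algebra of `G ^ n` -/

namespace GTemperleyLieb

open LabelledGraph BrauerDiagram

namespace GTL

section strands

variable {G : Type*} [CommGroup G] {n : ℕ} {k : Type*} [CommRing k] [MulSemiringAction G k]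
  {δ : k}

/-- The diagram with `n` horizontal edges labelled by the components of `g`. -/
def strandsDiagram (g : Fin n → G) : TLDiagram G n := ⟨strands g, isPlanar_strands g⟩

theorem basis_strands_mul (g h : Fin n → G) : basis G n δ (strandsDiagram g) *
    basis G n δ (strandsDiagram h) = basis G n δ (strandsDiagram (g * h)) := by
  have h1 : TLDiagram.comp (strandsDiagram g) (strandsDiagram h) = strandsDiagram (g * h) :=
    Subtype.ext (strands_comp g h)
  have h2 : loops (strandsDiagram g).1 (strandsDiagram h).1 = 0 :=
    (isThrough_strands g).loops_eq (isThrough_strands h)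
  rw [basis_mul_basis, h1, TLDiagram.weight, h2, Multiset.map_zero, Multiset.prod_zero, one_smul]

theorem eq_strandsDiagram {x : TLDiagram G n} (hx : x.1.IsThrough) :
    ∃ g, x = strandsDiagram g := by
  obtain ⟨g, hg⟩ := eq_strands x.2 hx
  exact ⟨g, Subtype.ext hg⟩

/-- The inclusion of the group algebra of `G ^ n` as the span of the diagrams without left-to-left
and right-to-right connections. -/
noncomputable def ofStrands (G : Type*) [CommGroup G] (n : ℕ) {k : Type*} [CommRing k]
    [MulSemiringAction G k] (δ : k) : MonoidAlgebra k (Fin n → G) →ₐ[k] GTL G n δ :=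
  MonoidAlgebra.lift k (GTL G n δ) (Fin n → G)
    { toFun g := basis G n δ (strandsDiagram g)
      map_one' := congrArg (basis G n δ) (Subtype.ext strands_one)
      map_mul' g h := (basis_strands_mul g h).symm }

theorem ofStrands_single (g : Fin n → G) (r : k) :
    ofStrands G n δ (MonoidAlgebra.single g r) = r • basis G n δ (strandsDiagram g) := by
  simp [ofStrands, MonoidAlgebra.lift_single]

open Classical in
/-- The projection onto the group algebra of `G ^ n`, as a linear map. -/
noncomputable def toStrandsLinear (G : Type*) [CommGroup G] (n : ℕ) {k : Type*} [CommRing k]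
    (δ : k) : GTL G n δ →ₗ[k] MonoidAlgebra k (Fin n → G) :=
  (basis G n δ).constr k fun x =>
    if x.1.IsThrough then MonoidAlgebra.single (fun i => x.1.label (Sum.inl i)) 1 else 0

theorem toStrandsLinear_strands (g : Fin n → G) :
    toStrandsLinear G n δ (basis G n δ (strandsDiagram g)) = MonoidAlgebra.single g 1 := by
  rw [toStrandsLinear, Module.Basis.constr_basis, if_pos]
  · rfl
  · exact isThrough_strands g

theorem toStrandsLinear_of_mem {a : GTL G n δ} (ha : a ∈ spanOf δ (nonThrough G n)) :
    toStrandsLinear G n δ a = 0 := by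
  induction ha using Submodule.span_induction with
  | mem _ h =>
    obtain ⟨x, hx, rfl⟩ := h
    rw [toStrandsLinear, Module.Basis.constr_basis, if_neg hx]
  | zero => exact map_zero _
  | add _ _ _ _ h1 h2 => rw [map_add, h1, h2, add_zero]
  | smul r _ _ h => rw [map_smul, h, smul_zero]

/-- Planar diagrams without left-to-left and right-to-right connections are strands, so the algebra
is the direct sum of the group algebra and the ideal. -/
theorem sub_ofStrands_mem (a : GTL G n δ) :
    a - ofStrands G n δ (toStrandsLinear G n δ a) ∈ spanOf δ (nonThrough G n) := by
  induction a using induction with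
  | h0 => simp
  | hadd a b ha hb => rw [map_add, map_add, add_sub_add_comm]; exact add_mem ha hb
  | hsmul r a ha => rw [map_smul, map_smul, ← smul_sub]; exact Submodule.smul_mem _ _ ha
  | hbasis x =>
    by_cases hx : x.1.IsThrough
    · obtain ⟨g, rfl⟩ := eq_strandsDiagram hx
      rw [toStrandsLinear_strands, ofStrands_single, one_smul, sub_self]
      exact zero_mem _
    · have h : basis G n δ x ∈ spanOf δ (nonThrough G n) := basis_mem_spanOf hx
      rw [toStrandsLinear_of_mem h, map_zero, sub_zero]
      exact h

theorem toStrandsLinear_ofStrands (b : MonoidAlgebra k (Fin n → G)) :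
    toStrandsLinear G n δ (ofStrands G n δ b) = b := by
  induction b using MonoidAlgebra.induction_on with
  | of g =>
    rw [MonoidAlgebra.of_apply, ofStrands_single, one_smul, toStrandsLinear_strands]
  | add a b ha hb => rw [map_add, map_add, ha, hb]
  | smul r a ha => rw [map_smul, map_smul, ha]

/-- The projection onto the group algebra of `G ^ n`. -/
noncomputable def toStrands (G : Type*) [CommGroup G] (n : ℕ) {k : Type*} [CommRing k]
    [MulSemiringAction G k] (δ : k) : GTL G n δ →ₐ[k] MonoidAlgebra k (Fin n → G) :=
  AlgHom.ofLinearMap (toStrandsLinear G n δ)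
    (by rw [← map_one (ofStrands G n δ), toStrandsLinear_ofStrands])
    (by
      intro a b
      -- With `a'` and `b'` for the strand parts, `a b - a' b' = (a - a') b + a' (b - b')`. Both
      -- summands lie in the ideal, which the projection kills.
      have h1 : a * b - ofStrands G n δ (toStrandsLinear G n δ a * toStrandsLinear G n δ b) ∈
          spanOf δ (nonThrough G n) := by
        have h2 := rightClosed_nonThrough.mul_mem (sub_ofStrands_mem a) b
        have h3 := mul_mem_nonThrough (ofStrands G n δ (toStrandsLinear G n δ a))
          (sub_ofStrands_mem b)
        have h4 := add_mem h2 h3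
        rw [sub_mul, mul_sub, sub_add_sub_cancel] at h4
        rwa [map_mul]
      have h2 := toStrandsLinear_of_mem h1
      rwa [map_sub, toStrandsLinear_ofStrands, sub_eq_zero] at h2)

theorem toStrands_of_mem {a : GTL G n δ} (ha : a ∈ spanOf δ (nonThrough G n)) :
    toStrands G n δ a = 0 := toStrandsLinear_of_mem ha

theorem sub_mem_nonThrough (a : GTL G n δ) :
    a - ofStrands G n δ (toStrands G n δ a) ∈ spanOf δ (nonThrough G n) := sub_ofStrands_mem a

theorem toStrands_ofStrands (b : MonoidAlgebra k (Fin n → G)) :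
    toStrands G n δ (ofStrands G n δ b) = b := toStrandsLinear_ofStrands b

theorem aug_basis_of_mem {x : TLDiagram G n} (hx : x ∈ nonThrough G n) :
    aug G n δ (basis G n δ x) = 0 := by
  show augLinear G n δ _ = 0
  rw [augLinear_basis, if_neg hx]

theorem aug_of_mem {a : GTL G n δ} (ha : a ∈ spanOf δ (nonThrough G n)) : aug G n δ a = 0 := by
  induction ha using Submodule.span_induction with
  | mem _ h =>
    obtain ⟨x, hx, rfl⟩ := h
    exact aug_basis_of_mem hx
  | zero => exact map_zero _
  | add _ _ _ _ h1 h2 => rw [map_add, h1, h2, add_zero]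
  | smul r _ _ h => rw [map_smul, h, smul_zero]

theorem aug_ofStrands (b : MonoidAlgebra k (Fin n → G)) :
    aug G n δ (ofStrands G n δ b) = groupAlgebraAug k (Fin n → G) b := by
  induction b using MonoidAlgebra.induction_on with
  | of g =>
    rw [MonoidAlgebra.of_apply, ofStrands_single, one_smul]
    show augLinear G n δ _ = _
    rw [augLinear_basis]
    exact (if_pos (isThrough_strands g)).trans (by simp [groupAlgebraAug])
  | add a b ha hb => rw [map_add, map_add, map_add, ha, hb]
  | smul r a ha => rw [map_smul, map_smul, map_smul, ha]

theorem groupAlgebraAug_toStrands (a : GTL G n δ) :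
    groupAlgebraAug k (Fin n → G) (toStrands G n δ a) = aug G n δ a := by
  rw [← aug_ofStrands (δ := δ), ← sub_eq_zero, ← neg_eq_zero, neg_sub, ← map_sub]
  exact aug_of_mem (sub_mem_nonThrough a)

/-- The two-sided ideal spanned by the diagrams with left-to-left or right-to-right
connections. -/
noncomputable def nonThroughIdeal (G : Type*) [CommGroup G] (n : ℕ) {k : Type*} [CommRing k]
    [MulSemiringAction G k] (δ : k) : Ideal (GTL G n δ) where
  carrier := spanOf δ (nonThrough G n)
  add_mem' := add_mem
  zero_mem' := zero_mem _
  smul_mem' a _ hb := mul_mem_nonThrough a hb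

section modules

/-- The submodule generated by the multiples of the diagrams with left-to-left or right-to-right
connections. -/
noncomputable abbrev nonThroughPart (G : Type*) [CommGroup G] (n : ℕ) {k : Type*} [CommRing k]
    [MulSemiringAction G k] (δ : k) (Q : Type*) [AddCommGroup Q] [Module (GTL G n δ) Q] :
    Submodule (GTL G n δ) Q := nonThroughIdeal G n δ • ⊤

variable {Q : Type*} [AddCommGroup Q] [Module (GTL G n δ) Q]

/-- This identifies the submodule `IQ` with the elements to which the acyclicity theorem applies. -/
theorem mem_nonThroughPart_iff [Module.Projective (GTL G n δ) Q] {x : Q} :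
    x ∈ nonThroughPart G n δ Q ↔ Supp (δ := δ) (nonThrough G n) x := by
  constructor
  · intro hx
    induction hx using Submodule.smul_induction_on' with
    | smul a ha y _ => exact rightClosed_nonThrough.supp_smul ha y
    | add x _ y _ hx hy => exact hx.add hy
  · intro hx
    obtain ⟨s, hs⟩ := exists_coeff (GTL G n δ) Q
    rw [← hs x]
    exact sum_mem fun q _ => Submodule.smul_mem_smul (hx (Finsupp.lapply q ∘ₗ s)) trivial

theorem smul_sub_smul_mem (a : GTL G n δ) (x : Q) :
    a • x - ofStrands G n δ (toStrands G n δ a) • x ∈ nonThroughPart G n δ Q := by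
  rw [← sub_smul]
  exact Submodule.smul_mem_smul (sub_mem_nonThrough a) trivial

end modules

end strands

/-! ### Reduction of modules modulo the ideal -/

section functor

open CategoryTheory

variable {k G : Type u} [CommGroup G] [CommRing k] [MulSemiringAction G k] (n : ℕ) (δ : k)

theorem nonThroughPart_le_comap {N N' : ModuleCat.{u} (GTL G n δ)} (f : N ⟶ N') :
    nonThroughPart G n δ N ≤ (nonThroughPart G n δ N').comap f.hom := by
  rw [Submodule.smul_le]
  intro a ha x _
  rw [Submodule.mem_comap, map_smul]
  exact Submodule.smul_mem_smul ha trivial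

/-- The functor that divides a module over the `G`-Temperley-Lieb algebra by the multiples of the
diagrams with left-to-left or right-to-right connections. -/
noncomputable def strandFunctor (G : Type u) [CommGroup G] {k : Type u} [CommRing k]
    [MulSemiringAction G k] (n : ℕ) (δ : k) :
    ModuleCat.{u} (GTL G n δ) ⥤ ModuleCat.{u} (MonoidAlgebra k (Fin n → G)) where
  obj N := (ModuleCat.restrictScalars (ofStrands G n δ).toRingHom).obj
    (ModuleCat.of (GTL G n δ) (N ⧸ nonThroughPart G n δ N))
  map {N N'} f := (ModuleCat.restrictScalars (ofStrands G n δ).toRingHom).map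
    (ModuleCat.ofHom (Submodule.mapQ _ _ f.hom (nonThroughPart_le_comap n δ f)))
  map_id N := by
    refine ModuleCat.hom_ext (LinearMap.ext fun x => ?_)
    obtain ⟨x, rfl⟩ := Submodule.Quotient.mk_surjective _ x
    rfl
  map_comp f g := by
    refine ModuleCat.hom_ext (LinearMap.ext fun x => ?_)
    obtain ⟨x, rfl⟩ := Submodule.Quotient.mk_surjective _ x
    rfl

variable {n δ}

/-- The class of an element in the quotient. -/
noncomputable def strandMk (N : ModuleCat.{u} (GTL G n δ)) : N →+ (strandFunctor G n δ).obj N where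
  toFun x := Submodule.Quotient.mk (p := nonThroughPart G n δ N) x
  map_zero' := rfl
  map_add' _ _ := rfl

theorem strandMk_surjective (N : ModuleCat.{u} (GTL G n δ)) : Function.Surjective (strandMk N) :=
  Submodule.Quotient.mk_surjective _

theorem strandMk_eq_zero {N : ModuleCat.{u} (GTL G n δ)} {x : N} :
    strandMk N x = 0 ↔ x ∈ nonThroughPart G n δ N :=
  Submodule.Quotient.mk_eq_zero _

theorem smul_strandMk {N : ModuleCat.{u} (GTL G n δ)} (b : MonoidAlgebra k (Fin n → G)) (x : N) :
    b • strandMk N x = strandMk N (ofStrands G n δ b • x) := rfl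

theorem strandMk_smul {N : ModuleCat.{u} (GTL G n δ)} (a : GTL G n δ) (x : N) :
    strandMk N (a • x) = toStrands G n δ a • strandMk N x := by
  rw [smul_strandMk, ← sub_eq_zero, ← map_sub, strandMk_eq_zero]
  exact smul_sub_smul_mem a x

/-- Additive maps on the quotient. -/
noncomputable def strandLift (N : ModuleCat.{u} (GTL G n δ)) {M : Type*} [AddCommGroup M] (f : N →+ M)
    (hf : ∀ a ∈ spanOf δ (nonThrough G n), ∀ x, f (a • x) = 0) :
    (strandFunctor G n δ).obj N →+ M :=
  QuotientAddGroup.lift (nonThroughPart G n δ N).toAddSubgroup f (by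
    intro x hx
    change x ∈ nonThroughPart G n δ N at hx
    induction hx using Submodule.smul_induction_on' with
    | smul a ha y _ => exact hf a ha y
    | add x _ y _ hx hy => exact (map_add f x y).trans (by rw [hx, hy, add_zero]))

theorem strandLift_mk (N : ModuleCat.{u} (GTL G n δ)) {M : Type*} [AddCommGroup M] (f : N →+ M)
    (hf : ∀ a ∈ spanOf δ (nonThrough G n), ∀ x, f (a • x) = 0) (x : N) :
    strandLift N f hf (strandMk N x) = f x := rfl

instance : (strandFunctor G n δ).Additive where
  map_add {N N' f g} := by
    refine ModuleCat.hom_ext (LinearMap.ext fun x => ?_)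
    obtain ⟨x, rfl⟩ := strandMk_surjective N x
    rfl

/-- Base change to a quotient ring preserves projectivity. Concretely, a surjection from a free
module over the group algebra is viewed as a map over the full algebra, the quotient map from `N` is
lifted through it, and the lift descends because the ideal acts as `0` on its target. -/
theorem projective_strandFunctor_obj (N : ModuleCat.{u} (GTL G n δ))
    [Module.Projective (GTL G n δ) N] :
    Module.Projective (MonoidAlgebra k (Fin n → G)) ((strandFunctor G n δ).obj N) := by
  refine Module.Projective.of_lifting_property'' fun f hf => ?_
  let _ : Module (GTL G n δ) ((strandFunctor G n δ).obj N) :=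
    Module.compHom _ (toStrands G n δ).toRingHom
  let _ : Module (GTL G n δ) ((strandFunctor G n δ).obj N →₀ MonoidAlgebra k (Fin n → G)) :=
    Module.compHom _ (toStrands G n δ).toRingHom
  let f' : ((strandFunctor G n δ).obj N →₀ MonoidAlgebra k (Fin n → G)) →ₗ[GTL G n δ]
      (strandFunctor G n δ).obj N :=
    { toFun := f
      map_add' := map_add f
      map_smul' := fun a x => map_smul f (toStrands G n δ a) x }
  let g : N →ₗ[GTL G n δ] (strandFunctor G n δ).obj N :=
    { toFun := strandMk N
      map_add' := map_add _
      map_smul' := fun a x => strandMk_smul a x }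
  obtain ⟨h, hh⟩ := Module.projective_lifting_property f' g hf
  have h1 : ∀ (a : GTL G n δ) x, h (a • x) = toStrands G n δ a • h x := fun a x => map_smul h a x
  let h' := strandLift N h.toAddMonoidHom fun a ha x => by
    show h (a • x) = 0
    rw [h1, toStrands_of_mem ha, zero_smul]
  refine ⟨{ toFun := h', map_add' := map_add h', map_smul' := fun b x => ?_ },
    LinearMap.ext fun x => ?_⟩
  · obtain ⟨x, rfl⟩ := strandMk_surjective N x
    show h (ofStrands G n δ b • x) = b • h x
    rw [h1, toStrands_ofStrands]
  · obtain ⟨x, rfl⟩ := strandMk_surjective N x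
    exact LinearMap.congr_fun hh x

theorem trivialLeft_smul_eq_zero {A : Type u} [Ring A] [Algebra k A] {ε : A →ₐ[k] k} {a : A}
    (h : ε a = 0) (m : trivialLeft ε) : a • m = 0 :=
  (congrArg (fun r : k => r * (show k from m)) h).trans (zero_mul (show k from m))

/-- The augmentation induced on the quotient. -/
noncomputable def strandAug {N : ModuleCat.{u} (GTL G n δ)} (f : N ⟶ trivialLeft (aug G n δ)) :
    (strandFunctor G n δ).obj N ⟶ trivialLeft (groupAlgebraAug k (Fin n → G)) :=
  let f' := strandLift N f.hom.toAddMonoidHom fun a ha x =>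
    (map_smul f.hom a x).trans (trivialLeft_smul_eq_zero (aug_of_mem ha) _)
  let f'' : (strandFunctor G n δ).obj N →ₗ[MonoidAlgebra k (Fin n → G)]
      trivialLeft (groupAlgebraAug k (Fin n → G)) :=
    { toFun := f'
      map_add' := map_add f'
      map_smul' := fun b x => by
        obtain ⟨x, rfl⟩ := strandMk_surjective N x
        refine (map_smul f.hom (ofStrands G n δ b) x).trans ?_
        exact congrArg (fun r : k => r * (show k from f.hom x)) (aug_ofStrands (δ := δ) b) }
  ModuleCat.ofHom (X := (strandFunctor G n δ).obj N)
    (Y := trivialLeft (groupAlgebraAug k (Fin n → G))) f''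

end functor

/-! ### Reducing a projective resolution -/

section resolution

open CategoryTheory

/-- A projective resolution of a module from an exact complex of projective modules. -/
noncomputable def _root_.ModuleCat.projectiveResolutionOfExact {R : Type u} [Ring R]
    {Z : ModuleCat.{u} R} (K : ChainComplex (ModuleCat.{u} R) ℕ)
    (hK : ∀ i, Module.Projective R (K.X i)) (ε : K.X 0 ⟶ Z) (h : K.d 1 0 ≫ ε = 0)
    (hε : Function.Surjective ε.hom) (h0 : ∀ x, ε.hom x = 0 → ∃ z, (K.d 1 0).hom z = x)
    (hs : ∀ i x, (K.d (i + 1) i).hom x = 0 → ∃ z, (K.d (i + 2) (i + 1)).hom z = x) :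
    ProjectiveResolution Z where
  complex := K
  projective i := (IsProjective.iff_projective _).1 (hK i)
  π := (ChainComplex.toSingle₀Equiv _ _).symm ⟨ε, h⟩
  quasiIso := ⟨fun n => by
    cases n with
    | zero =>
      rw [ChainComplex.quasiIsoAt₀_iff, ShortComplex.quasiIso_iff_of_zeros']
      · exact ⟨(ShortComplex.moduleCat_exact_iff _).2 h0, (ModuleCat.epi_iff_surjective _).2 hε⟩
      · exact K.shape _ _ (by simp)
      all_goals rfl
    | succ i =>
      rw [quasiIsoAt_iff_exactAt']
      · rw [HomologicalComplex.exactAt_iff' _ (i + 1 + 1) (i + 1) i (by simp) (by simp)]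
        exact (ShortComplex.moduleCat_exact_iff _).2 (hs i)
      · apply ChainComplex.exactAt_succ_single_obj⟩

variable {k G : Type u} [CommGroup G] [CommRing k] [MulSemiringAction G k] {n : ℕ} {δ : k}

/-- Dividing a projective resolution of the trivial module by the multiples of the diagrams with
left-to-left or right-to-right connections gives a projective resolution of the trivial module of
the group algebra. -/
noncomputable def strandResolution (hn : Odd n)
    (P : ProjectiveResolution (trivialLeft (aug G n δ))) :
    ProjectiveResolution (trivialLeft (groupAlgebraAug k (Fin n → G))) := by
  have hproj : ∀ i, Module.Projective (GTL G n δ) (P.complex.X i) := fun i =>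
    (IsProjective.iff_projective _).2 (P.projective i)
  let ε := (ChainComplex.toSingle₀Equiv _ _ P.π).1
  have hdε : P.complex.d 1 0 ≫ ε = 0 := (ChainComplex.toSingle₀Equiv _ _ P.π).2
  have hsurj : Function.Surjective ε.hom :=
    (ModuleCat.epi_iff_surjective _).1 (inferInstanceAs (Epi (P.π.f 0)))
  have h0 : ∀ x, ε.hom x = 0 → ∃ z, (P.complex.d 1 0).hom z = x := by
    refine (ShortComplex.moduleCat_exact_iff (ShortComplex.mk _ _ hdε)).1 ?_
    exact ShortComplex.exact_of_g_is_cokernel _ P.isColimitCokernelCofork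
  have hs : ∀ i x, (P.complex.d (i + 1) i).hom x = 0 →
      ∃ z, (P.complex.d (i + 2) (i + 1)).hom z = x := fun i =>
    (ShortComplex.moduleCat_exact_iff _).1 (P.exact_succ i)
  have hdd : ∀ i x, (P.complex.d (i + 1) i).hom ((P.complex.d (i + 2) (i + 1)).hom x) = 0 :=
    fun i x => LinearMap.congr_fun
      (congrArg ModuleCat.Hom.hom (P.complex.d_comp_d (i + 2) (i + 1) i)) x
  have hac := acyclic_nonThrough (δ := δ) (Q := fun i => P.complex.X i) (d := fun i => (P.complex.d (i + 1) i).hom) (ε := ε.hom) hn hdd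
    h0 hs (fun x hx m => trivialLeft_smul_eq_zero (aug_basis_of_mem hx) m)
  refine ModuleCat.projectiveResolutionOfExact
    (((strandFunctor G n δ).mapHomologicalComplex _).obj P.complex)
    (fun i => projective_strandFunctor_obj _) (strandAug ε) ?_ ?_ ?_ ?_
  · refine ModuleCat.hom_ext (LinearMap.ext fun x => ?_)
    obtain ⟨x, rfl⟩ := strandMk_surjective _ x
    exact LinearMap.congr_fun (congrArg ModuleCat.Hom.hom hdε) x
  · intro y
    obtain ⟨x, rfl⟩ := hsurj y
    exact ⟨strandMk _ x, rfl⟩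
  -- In degree `0` no acyclicity is needed: the induced augmentation takes the same value on the
  -- class of `x` as the original one on `x`.
  · intro x hx
    obtain ⟨x, rfl⟩ := strandMk_surjective _ x
    obtain ⟨z, hz⟩ := h0 x hx
    exact ⟨strandMk _ z, congrArg (strandMk _) hz⟩
  · intro i x hx
    obtain ⟨x, rfl⟩ := strandMk_surjective _ x
    have hx1 : Supp (δ := δ) (nonThrough G n) ((P.complex.d (i + 1) i).hom x) :=
      mem_nonThroughPart_iff.1 (strandMk_eq_zero.1 hx)
    -- The class of `x` is a cycle, so `d x` lies in `IQ`. Acyclicity gives `z` in `IQ` with the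
    -- same boundary; then `x - z` is a cycle of the resolution with the same class as `x`.
    obtain ⟨z, hz, hz'⟩ : ∃ z : P.complex.X (i + 1), Supp (δ := δ) (nonThrough G n) z ∧
        (P.complex.d (i + 1) i).hom z = (P.complex.d (i + 1) i).hom x := by
      cases i with
      | zero => exact hac.zero _ hx1
      | succ i => exact hac.succ i _ hx1 (hdd i x)
    obtain ⟨w, hw⟩ := hs i (x - z) (by rw [map_sub, hz', sub_self])
    refine ⟨strandMk _ w, ?_⟩
    show strandMk _ ((P.complex.d (i + 2) (i + 1)).hom w) = strandMk _ x
    rw [hw, map_sub, strandMk_eq_zero.2 (mem_nonThroughPart_iff.2 hz), sub_zero]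

end resolution

end GTL

end GTemperleyLieb

/-! ### Tensor products with the trivial module -/

namespace GTemperleyLieb

section tensor

open CategoryTheory TensorProduct

attribute [local instance] scalarModule

variable {k A : Type u} [CommRing k] [Ring A] [Algebra k A] (ε : A →ₐ[k] k)

theorem trivialRight_smul (r : k) (m : trivialRight ε) :
    (r • m : trivialRight ε) = (r * (show k from m) : k) :=
  congrArg (fun s : k => s * (show k from m)) (ε.commutes r)

/-- The class of `1 ⊗ x` in the tensor product of the trivial right module with a module. -/
noncomputable def tensorMk (N : ModuleCat.{u} A) :
    N →+ (tensorFunctor k (trivialRight ε)).obj N where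
  toFun x := (balancingSubmodule k (trivialRight ε) N).mkQ ((show trivialRight ε from (1 : k)) ⊗ₜ x)
  map_zero' := by rw [TensorProduct.tmul_zero, map_zero]; rfl
  map_add' x y := by rw [TensorProduct.tmul_add, map_add]; rfl

/-- The scalar `a` moves across the tensor sign to `1`, on which it acts as `ε a`. -/
theorem tensorMk_smul {N : ModuleCat.{u} A} (a : A) (x : N) :
    tensorMk ε N (a • x) = ε a • tensorMk ε N x := by
  have h1 : (MulOpposite.op a • (show trivialRight ε from (1 : k)) : trivialRight ε) =
      ε a • (show trivialRight ε from (1 : k)) := by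
    rw [trivialRight_smul]
    rfl
  have h2 : (balancingSubmodule k (trivialRight ε) N).mkQ
      ((MulOpposite.op a • (show trivialRight ε from (1 : k))) ⊗ₜ x) =
      (balancingSubmodule k (trivialRight ε) N).mkQ
        ((show trivialRight ε from (1 : k)) ⊗ₜ (a • x)) := by
    rw [← sub_eq_zero, ← map_sub, Submodule.mkQ_apply, Submodule.Quotient.mk_eq_zero]
    exact Submodule.subset_span ⟨_, a, x, rfl⟩
  rw [h1, ← TensorProduct.smul_tmul', map_smul] at h2
  exact h2.symm

variable {ε}

theorem tensor_hom_ext {N : ModuleCat.{u} A} {W : ModuleCat.{u} k}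
    {f g : (tensorFunctor k (trivialRight ε)).obj N ⟶ W}
    (h : ∀ x, f.hom (tensorMk ε N x) = g.hom (tensorMk ε N x)) : f = g := by
  refine ModuleCat.hom_ext (Submodule.linearMap_qext _ (TensorProduct.ext' fun m x => ?_))
  have h1 : m ⊗ₜ[k] x = (show k from m) • ((show trivialRight ε from (1 : k)) ⊗ₜ[k] x) := by
    rw [TensorProduct.smul_tmul', trivialRight_smul]
    congr 1
    exact (mul_one (show k from m)).symm
  rw [h1, map_smul, map_smul]
  exact congrArg _ (h x)

/-- A map on the tensor product of the trivial right module with `N`. -/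
noncomputable def tensorLift {N : ModuleCat.{u} A} {W : ModuleCat.{u} k} (φ : N →+ W)
    (hφ : ∀ (a : A) x, φ (a • x) = ε a • φ x) :
    (tensorFunctor k (trivialRight ε)).obj N ⟶ W :=
  ModuleCat.ofHom (X := (tensorFunctor k (trivialRight ε)).obj N)
    ((balancingSubmodule k (trivialRight ε) N).liftQ
      (TensorProduct.lift (LinearMap.mk₂ k (fun m x => (show k from m) • φ x)
        (fun m m' x => add_smul (show k from m) (show k from m') (φ x))
        (fun r m x => by
          rw [trivialRight_smul]
          exact mul_smul r (show k from m) (φ x))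
        (fun m x y => by rw [map_add, smul_add])
        (fun r m x => by
          -- Linearity over `k` need not be assumed: it is the hypothesis on `φ` for the scalars of
          -- the algebra, on which the augmentation is the identity.
          have h : φ (r • x) = r • φ x := by
            refine (hφ (algebraMap k A r) x).trans ?_
            rw [ε.commutes]
            rfl
          rw [h, smul_comm])))
      (by
        rw [balancingSubmodule, Submodule.span_le]
        rintro _ ⟨m, a, x, rfl⟩
        rw [SetLike.mem_coe, LinearMap.mem_ker, map_sub, sub_eq_zero, TensorProduct.lift.tmul,
          TensorProduct.lift.tmul]
        change (ε a * (show k from m)) • φ x = (show k from m) • φ (a • x)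
        rw [hφ, smul_smul, mul_comm]))

theorem tensorLift_mk {N : ModuleCat.{u} A} {W : ModuleCat.{u} k} (φ : N →+ W)
    (hφ : ∀ (a : A) x, φ (a • x) = ε a • φ x) (x : N) :
    (tensorLift φ hφ).hom (tensorMk ε N x) = φ x := by
  show (1 : k) • φ x = φ x
  rw [one_smul]

end tensor

/-! ### Comparison of Tor over the two algebras -/

namespace GTL

open CategoryTheory

variable {k G : Type u} [CommGroup G] [CommRing k] [MulSemiringAction G k] {n : ℕ} {δ : k}

/-- The comparison of the tensor products over the `G`-Temperley-Lieb algebra and over the group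
algebra. -/
noncomputable def tensorStrandHom (N : ModuleCat.{u} (GTL G n δ)) :
    (tensorFunctor k (trivialRight (aug G n δ))).obj N ⟶
      (tensorFunctor k (trivialRight (groupAlgebraAug k (Fin n → G)))).obj
        ((strandFunctor G n δ).obj N) :=
  tensorLift ((tensorMk (groupAlgebraAug k (Fin n → G)) ((strandFunctor G n δ).obj N)).comp
    (strandMk N)) fun a x => by
      rw [AddMonoidHom.comp_apply, strandMk_smul, tensorMk_smul, groupAlgebraAug_toStrands]
      rfl

theorem tensorStrandHom_mk (N : ModuleCat.{u} (GTL G n δ)) (x : N) :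
    (tensorStrandHom N).hom (tensorMk (aug G n δ) N x) =
      tensorMk (groupAlgebraAug k (Fin n → G)) _ (strandMk N x) :=
  tensorLift_mk _ _ x

/-- The inverse of `tensorStrandHom`. -/
noncomputable def tensorStrandInv (N : ModuleCat.{u} (GTL G n δ)) :
    (tensorFunctor k (trivialRight (groupAlgebraAug k (Fin n → G)))).obj
        ((strandFunctor G n δ).obj N) ⟶ (tensorFunctor k (trivialRight (aug G n δ))).obj N :=
  tensorLift (strandLift N (tensorMk (aug G n δ) N) fun a ha x => by
    rw [tensorMk_smul, aug_of_mem ha, zero_smul]) fun b x => by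
      obtain ⟨x, rfl⟩ := strandMk_surjective N x
      rw [smul_strandMk, strandLift_mk, strandLift_mk, tensorMk_smul, aug_ofStrands]

theorem tensorStrandInv_mk (N : ModuleCat.{u} (GTL G n δ)) (x : N) :
    (tensorStrandInv N).hom (tensorMk (groupAlgebraAug k (Fin n → G)) _ (strandMk N x)) =
      tensorMk (aug G n δ) N x :=
  tensorLift_mk _ _ (strandMk N x)

/-- Tensoring with the trivial module factors through the quotient by the diagrams with
left-to-left or right-to-right connections. -/
noncomputable def tensorStrandIso (G : Type u) [CommGroup G] {k : Type u} [CommRing k]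
    [MulSemiringAction G k] (n : ℕ) (δ : k) :
    tensorFunctor k (trivialRight (aug G n δ)) ≅
      strandFunctor G n δ ⋙ tensorFunctor k (trivialRight (groupAlgebraAug k (Fin n → G))) :=
  NatIso.ofComponents
    (fun N =>
      { hom := tensorStrandHom N
        inv := tensorStrandInv N
        hom_inv_id := tensor_hom_ext fun x =>
          (congrArg _ (tensorStrandHom_mk N x)).trans (tensorStrandInv_mk N x)
        inv_hom_id := tensor_hom_ext fun x => by
          obtain ⟨x, rfl⟩ := strandMk_surjective N x
          exact (congrArg _ (tensorStrandInv_mk N x)).trans (tensorStrandHom_mk N x) })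
    (fun {N N'} f => tensor_hom_ext fun x => by
      have h1 := tensorStrandHom_mk N' (f.hom x)
      have h2 := congrArg ((tensorFunctor k (trivialRight (groupAlgebraAug k (Fin n → G)))).map
        ((strandFunctor G n δ).map f)).hom (tensorStrandHom_mk N x)
      exact h1.trans h2.symm)

/-- The homology of the `G`-Temperley-Lieb algebra on an odd number of strands. -/
noncomputable def torIso (G : Type u) [CommGroup G] {k : Type u} [CommRing k]
    [MulSemiringAction G k] {n : ℕ} (hn : Odd n) (δ : k) (i : ℕ) :
    torTrivial (aug G n δ) i ≅ torTrivial (groupAlgebraAug k (Fin n → G)) i :=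
  -- The complex of `strandResolution hn P` is by construction the image of `P.complex` under
  -- `strandFunctor`. So `tensorStrandIso`, applied in each degree, already lands in the complex
  -- that computes Tor over the group algebra.
  let P := projectiveResolution (trivialLeft (aug G n δ))
  P.isoLeftDerivedObj _ i ≪≫
    (HomologicalComplex.homologyFunctor _ _ i).mapIso
      ((NatIso.mapHomologicalComplex (tensorStrandIso G n δ) _).app P.complex) ≪≫
    ((strandResolution hn P).isoLeftDerivedObj
      (tensorFunctor k (trivialRight (groupAlgebraAug k (Fin n → G)))) i).symm

end GTL

end GTemperleyLieb

/-! ### Tor over the group algebra and group homology -/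

namespace GTemperleyLieb

section groupHomology

open CategoryTheory TensorProduct

variable {k G H : Type u} [CommRing k] [Group G] [Group H] (e : H ≃* G)

/-- Representations of `G` as modules over the group algebra of a group isomorphic to `G`. -/
noncomputable def repFunctor (k : Type u) [CommRing k] (e : H ≃* G) :
    Rep.{u} k G ⥤ ModuleCat.{u} (MonoidAlgebra k H) :=
  Rep.toModuleMonoidAlgebra ⋙
    ModuleCat.restrictScalars (MonoidAlgebra.domCongr k k e).toRingEquiv.toRingHom

instance : (repFunctor k e).IsEquivalence :=
  inferInstanceAs (Rep.toModuleMonoidAlgebra ⋙ ModuleCat.restrictScalars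
    (MonoidAlgebra.domCongr k k e).toRingEquiv.toRingHom).IsEquivalence

instance : (repFunctor k e).Additive where
  map_add := rfl

/-- A vector as an element of the corresponding module. -/
def repMk (V : Rep.{u} k G) : V →+ (repFunctor k e).obj V where
  toFun v := V.ρ.asModuleEquiv.symm v
  map_zero' := rfl
  map_add' _ _ := rfl

theorem repMk_surjective (V : Rep.{u} k G) : Function.Surjective (repMk e V) := fun v => ⟨v, rfl⟩

theorem single_smul_repMk (V : Rep.{u} k G) (h : H) (r : k) (v : V) :
    (MonoidAlgebra.single h r : MonoidAlgebra k H) • repMk e V v =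
      repMk e V (r • V.ρ (e h) v) := by
  show MonoidAlgebra.lift k (V →ₗ[k] V) G V.ρ
    (MonoidAlgebra.domCongr k k e (MonoidAlgebra.single h r)) v = r • V.ρ (e h) v
  simp

/-- An invariant linear map on a representation is compatible with the augmentation. -/
theorem map_smul_repMk {V : Rep.{u} k G} {W : Type u} [AddCommGroup W] [Module k W] (f : V →ₗ[k] W)
    (hf : ∀ g v, f (V.ρ g v) = f v) (b : MonoidAlgebra k H) (v : V) :
    (f.toAddMonoidHom : V →+ W) (b • repMk e V v : (repFunctor k e).obj V) =
      groupAlgebraAug k H b • f v := by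
  induction b using MonoidAlgebra.induction_linear with
  | zero =>
    rw [zero_smul, map_zero, zero_smul]
    exact map_zero f
  | add a b ha hb =>
    rw [add_smul, map_add, add_smul, ← ha, ← hb]
    exact map_add f _ _
  | single h r =>
    rw [single_smul_repMk]
    have h1 : groupAlgebraAug k H (MonoidAlgebra.single h r) = r := by simp [groupAlgebraAug]
    rw [h1, ← hf (e h) v]
    exact map_smul f r _

/-- The trivial representation corresponds to the trivial module. -/
noncomputable def repFunctorTrivialIso :
    (repFunctor k e).obj (Rep.trivial k G k) ≅ trivialLeft (groupAlgebraAug k H) :=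
  let f : (repFunctor k e).obj (Rep.trivial k G k) ≃ₗ[MonoidAlgebra k H]
      trivialLeft (groupAlgebraAug k H) :=
    { toFun := fun v => v
      invFun := fun v => v
      left_inv := fun _ => rfl
      right_inv := fun _ => rfl
      map_add' := fun _ _ => rfl
      map_smul' := fun b v =>
        map_smul_repMk e (V := Rep.trivial k G k) (LinearMap.id : k →ₗ[k] k) (fun _ _ => rfl) b v }
  { hom := ModuleCat.ofHom (X := (repFunctor k e).obj (Rep.trivial k G k))
      (Y := trivialLeft (groupAlgebraAug k H)) f.toLinearMap
    inv := ModuleCat.ofHom (X := trivialLeft (groupAlgebraAug k H))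
      (Y := (repFunctor k e).obj (Rep.trivial k G k)) f.symm.toLinearMap
    hom_inv_id := rfl
    inv_hom_id := rfl }

/-- The class of `1 ⊗ v` in the coinvariants. -/
noncomputable def coinvariantsMk (V : Rep.{u} k G) :
    V →ₗ[k] ((Rep.coinvariantsTensor k G).obj (Rep.trivial k G k)).obj V :=
  Rep.coinvariantsTensorMk (Rep.trivial k G k) V (1 : k)

theorem coinvariantsMk_ρ (V : Rep.{u} k G) (g : G) (v : V) :
    coinvariantsMk V (V.ρ g v) = coinvariantsMk V v :=
  Representation.Coinvariants.mk_self_apply ((Representation.trivial k G k).tprod V.ρ) g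
    ((1 : k) ⊗ₜ[k] v)

theorem coinvariants_hom_ext {V : Rep.{u} k G} {W : ModuleCat.{u} k}
    {f g : ((Rep.coinvariantsTensor k G).obj (Rep.trivial k G k)).obj V ⟶ W}
    (h : ∀ v, f.hom (coinvariantsMk V v) = g.hom (coinvariantsMk V v)) : f = g :=
  Rep.coinvariantsTensor_hom_ext (LinearMap.ext_ring (LinearMap.ext h))

/-- The comparison of the tensor product over the group algebra with the coinvariants. -/
noncomputable def tensorCoinvariantsHom (V : Rep.{u} k G) :
    (tensorFunctor k (trivialRight (groupAlgebraAug k H))).obj ((repFunctor k e).obj V) ⟶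
      ((Rep.coinvariantsTensor k G).obj (Rep.trivial k G k)).obj V :=
  tensorLift (N := (repFunctor k e).obj V) (coinvariantsMk V).toAddMonoidHom fun b v =>
    map_smul_repMk e (coinvariantsMk V) (coinvariantsMk_ρ V) b v

theorem tensorCoinvariantsHom_mk (V : Rep.{u} k G) (v : V) :
    (tensorCoinvariantsHom e V).hom (tensorMk (groupAlgebraAug k H) _ (repMk e V v)) =
      coinvariantsMk V v :=
  tensorLift_mk (N := (repFunctor k e).obj V) _ _ (repMk e V v)

/-- The class of `1 ⊗ v` in the tensor product over the group algebra. -/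
noncomputable def tensorRepMk (V : Rep.{u} k G) :
    V →ₗ[k] (tensorFunctor k (trivialRight (groupAlgebraAug k H))).obj ((repFunctor k e).obj V) where
  toFun v := tensorMk (groupAlgebraAug k H) _ (repMk e V v)
  map_add' v w := by rw [map_add, map_add]
  map_smul' r v := by
    have h1 : repMk e V (r • v) = (MonoidAlgebra.single 1 r : MonoidAlgebra k H) • repMk e V v := by
      rw [single_smul_repMk, map_one, map_one, Module.End.one_apply]
    have h2 : groupAlgebraAug k H (MonoidAlgebra.single 1 r) = r := by simp [groupAlgebraAug]
    rw [h1, tensorMk_smul, h2]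
    rfl

theorem tensorRepMk_ρ (V : Rep.{u} k G) (g : G) (v : V) :
    tensorRepMk (H := H) e V (V.ρ g v) = tensorRepMk e V v := by
  have h1 : repMk e V (V.ρ g v) =
      (MonoidAlgebra.single (e.symm g) 1 : MonoidAlgebra k H) • repMk e V v := by
    rw [single_smul_repMk, one_smul, MulEquiv.apply_symm_apply]
  have h2 : groupAlgebraAug k H (MonoidAlgebra.single (e.symm g) 1) = 1 := by
    simp [groupAlgebraAug]
  show tensorMk _ _ (repMk e V (V.ρ g v)) = _
  rw [h1, tensorMk_smul, h2, one_smul]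
  rfl

/-- The inverse of `tensorCoinvariantsHom`. -/
noncomputable def tensorCoinvariantsInv (V : Rep.{u} k G) :
    ((Rep.coinvariantsTensor k G).obj (Rep.trivial k G k)).obj V ⟶
      (tensorFunctor k (trivialRight (groupAlgebraAug k H))).obj ((repFunctor k e).obj V) :=
  ModuleCat.ofHom (X := ((Rep.coinvariantsTensor k G).obj (Rep.trivial k G k)).obj V)
    (Representation.Coinvariants.lift ((Representation.trivial k G k).tprod V.ρ)
      ((tensorRepMk (H := H) e V).comp (TensorProduct.lid k V).toLinearMap) fun g =>
        TensorProduct.ext' fun r v => by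
          show tensorRepMk e V (r • V.ρ g v) = tensorRepMk e V (r • v)
          rw [map_smul, map_smul, tensorRepMk_ρ])

theorem tensorCoinvariantsInv_mk (V : Rep.{u} k G) (v : V) :
    (tensorCoinvariantsInv e V).hom (coinvariantsMk V v) =
      tensorMk (groupAlgebraAug k H) _ (repMk e V v) := by
  show tensorRepMk e V ((1 : k) • v) = _
  rw [one_smul]
  rfl

/-- Tensoring with the trivial module over the group algebra is taking coinvariants. -/
noncomputable def tensorCoinvariantsIso :
    repFunctor k e ⋙ tensorFunctor k (trivialRight (groupAlgebraAug k H)) ≅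
      (Rep.coinvariantsTensor k G).obj (Rep.trivial k G k) :=
  NatIso.ofComponents
    (fun V =>
      { hom := tensorCoinvariantsHom e V
        inv := tensorCoinvariantsInv e V
        hom_inv_id := tensor_hom_ext fun x => by
          obtain ⟨v, rfl⟩ := repMk_surjective e V x
          exact (congrArg _ (tensorCoinvariantsHom_mk e V v)).trans (tensorCoinvariantsInv_mk e V v)
        inv_hom_id := coinvariants_hom_ext fun v =>
          (congrArg _ (tensorCoinvariantsInv_mk e V v)).trans (tensorCoinvariantsHom_mk e V v) })
    (fun {V V'} f => tensor_hom_ext fun x => by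
      obtain ⟨v, rfl⟩ := repMk_surjective e V x
      have h1 := tensorCoinvariantsHom_mk e V' (f.hom v)
      have h2 := congrArg (((Rep.coinvariantsTensor k G).obj (Rep.trivial k G k)).map f).hom
        (tensorCoinvariantsHom_mk e V v)
      exact h1.trans h2.symm)

open Classical in
/-- Group homology with trivial coefficients is `Tor` over the group algebra. -/
noncomputable def torGroupAlgebraIso (i : ℕ) :
    torTrivial (groupAlgebraAug k H) i ≅ groupHomology (Rep.trivial k G k) i :=
  -- The trivial module is the image of the trivial representation under the equivalence
  -- `repFunctor`, which carries the bar resolution to a projective resolution. Tensoring that with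
  -- the trivial module gives the coinvariants of the bar resolution, whose homology is group
  -- homology.
  let P := Rep.barResolution k G
  ((tensorFunctor k (trivialRight (groupAlgebraAug k H))).leftDerived i).mapIso
      (repFunctorTrivialIso e).symm ≪≫
    ((repFunctor k e).mapProjectiveResolution P).isoLeftDerivedObj
      (tensorFunctor k (trivialRight (groupAlgebraAug k H))) i ≪≫
    (HomologicalComplex.homologyFunctor _ _ i).mapIso
      ((NatIso.mapHomologicalComplex (tensorCoinvariantsIso e) _).app P.complex) ≪≫
    (groupHomologyIso (Rep.trivial k G k) i P).symm

end groupHomology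

end GTemperleyLieb

theorem mainTheorem9 {k G : Type u} [CommRing k] [CommGroup G] [MulSemiringAction G k]
    (δ : k) (n : ℕ) (hn : Odd n) :
    (∀ i : ℕ, Nonempty (GTemperleyLieb.torTrivial (GTemperleyLieb.GTL.aug G n δ) i ≅
      GTemperleyLieb.torTrivial (GTemperleyLieb.groupAlgebraAug k (Fin n → G)) i)) ∧
    (n = 1 → ∀ i : ℕ, Nonempty (GTemperleyLieb.torTrivial (GTemperleyLieb.GTL.aug G n δ) i ≅
      groupHomology (Rep.trivial k G k) i)) := by
  refine ⟨fun i => ⟨GTemperleyLieb.GTL.torIso G hn δ i⟩, ?_⟩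
  rintro rfl i
  exact ⟨GTemperleyLieb.GTL.torIso G hn δ i ≪≫
    GTemperleyLieb.torGroupAlgebraIso (MulEquiv.funUnique (Fin 1) G) i⟩
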